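/- Let $k,d\ge 1$. Let $V$ be the vertex set of the semi-infinite Cayley tree of order $k$ (every vertex $x$ has exactly $k$ direct successors, forming the set $S(x)$), $W_n$ the set of vertices at distance $n$ from the root, $\Lambda_n=W_0\cup\dots\cup W_n$ (with $\Lambda_{-1}=\emptyset$) and $\Lambda_{[n,n+1]}=W_n\cup W_{n+1}$. For finite $\Lambda\subset V$ let $\mathcal A_\Lambda=\bigotimes_{x\in\Lambda}M_d(\mathbb C)$, with $\mathcal A_X\cong\mathcal A_X\otimes 1\subseteq\mathcal A_Y$ for $X\subseteq Y$, and let $\mathcal A_V$ be the quasi-local $C^*$-algebra generated by the $\mathcal A_\Lambda$. Let $T^Y_X:\mathcal A_Y\to\mathcal A_X$ be the partial trace, $T^Y_X(a_X\otimes a_{Y\setminus X})=\mathrm{Tr}(a_{Y\setminus X})\,a_X$. For a state $\varphi$ on $\mathcal A_V$ let $D_\Lambda\in\mathcal A_\Lambda$ be the density matrix of $\varphi\lceil_{\mathcal A_\Lambda}$, i.e. $\varphi(a)=\mathrm{Tr}(D_\Lambda a)$ for $a\in\mathcal A_\Lambda$, and let $S(\varphi\lceil_{\mathcal A_\Lambda})=-\mathrm{Tr}(D_\Lambda\log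 D_\Lambda)$ (with $0\log 0=0$) be the von Neumann entropy. A transition expectation is a completely positive identity preserving map. A quasi-conditional expectation with respect to $\mathcal C\subseteq\mathcal B\subseteq\mathcal A$ is a transition expectation $E:\mathcal A\to\mathcal B$ with $E(ca)=cE(a)$ for all $c\in\mathcal C$, $a\in\mathcal A$. A state $\varphi$ on $\mathcal A_V$ is a quantum Markov state (QMS) with quasi-conditional expectations $(E_{\Lambda_n})_{n\ge0}$, $E_{\Lambda_n}$ being one with respect to $\mathcal A_{\Lambda_{n-1}}\subseteq\mathcal A_{\Lambda_n}\subseteq\mathcal A_{\Lambda_{n+1}}$, if (i) it is a quantum Markov chain: there are a state $\phi_0$ on $\mathcal A_{\Lambda_0}$ and positive $h_n\in\mathcal A_{\Lambda_n}$ such that $\varphi(a)=\lim_{n\to\infty}\phi_0\circ E_{\Lambda_0}\circ\dots\circ E_{\Lambda_n}(h_{n+1}^{1/2}\,a\,h_{n+1}^{1/2})$ for every $a\in\bigcup_m\mathcal A_{\Lambda_m}$; and (ii) $\varphi\lceil_{\mathcal A_{\Lambda_n}}\circ E_{\Lambda_n}=\varphi\lceil_{\mathcal A_{\Lambda_{n+1}}}$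 for all $n\ge 0$. **Theorem.** Let $\varphi$ be a QMS on $\mathcal A_V$ with quasi-conditional expectations $(E_{\Lambda_n})_n$. (1) For every $n\ge0$, $$S(\varphi\lceil_{\mathcal A_{\Lambda_{n+1}}})+S(\varphi\lceil_{\mathcal A_{W_n}})=S(\varphi\lceil_{\mathcal A_{\Lambda_n}})+S(\varphi\lceil_{\mathcal A_{\Lambda_{[n,n+1]}}}).$$ (2) Let $n\ge 0$ and suppose that $E_{\Lambda_n}=\mathrm{id}_{\Lambda_{n-1}}\otimes\mathcal E_{W_n}$ with a localized transition expectation $\mathcal E_{W_n}=\bigotimes_{x\in W_n}\mathcal E_x:\mathcal A_{\Lambda_{[n,n+1]}}\to\mathcal A_{W_n}$, where each $\mathcal E_x:\mathcal A_{\{x\}\cup S(x)}\to\mathcal A_{\{x\}}$ is a transition expectation with conditional density amplitude $K_{\{x\}\cup S(x)}\in\mathcal A_{\{x\}\cup S(x)}$, that is, $\mathcal E_x(a)=T^{\{x\}\cup S(x)}_{\{x\}}\big(K_{\{x\}\cup S(x)}^*\,a\,K_{\{x\}\cup S(x)}\big)$ for all $a\in\mathcal A_{\{x\}\cup S(x)}$.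 Put $K_{[n,n+1]}=\bigotimes_{x\in W_n}K_{\{x\}\cup S(x)}$. If $K_{[n,n+1]}$ and $D_{\Lambda_n}$ commute (in $\mathcal A_{\Lambda_{n+1}}$), then $$S(\varphi\lceil_{\mathcal A_{\Lambda_{n+1}}})-S(\varphi\lceil_{\mathcal A_{\Lambda_n}})=-2\sum_{x\in W_n}\varphi\big(\log|K_{\{x\}\cup S(x)}|\big),$$ where $|K|=(KK^*)^{1/2}$ (which is also $(K^*K)^{1/2}$ when $K$ is normal), and where the logarithm is extended by $\log 0=0$ in the functional calculus. -/

import Mathlib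

open scoped CStarAlgebra MatrixOrder Matrix.Norms.L2Operator ComplexOrder ENNReal Topology

namespace CayleyQMS

/-! ### The semi-infinite Cayley tree, in coordinates -/

/-- Vertices of the semi-infinite Cayley tree of order `k`: the root is the empty list, and a vertex
at distance `n` from the root is its list of coordinates `(i₁, …, iₙ)`. -/
abbrev Vertex (k : ℕ) : Type := List (Fin k)

/-- The level `W_n`: the vertices at distance `n` from the root. -/
def level (k n : ℕ) : Finset (Vertex k) :=
  Finset.univ.image (fun i : Fin n → Fin k => List.ofFn i)

theorem mem_level {k n : ℕ} {x : Vertex k} : x ∈ level k n ↔ x.length = n := by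
  constructor
  · intro h
    obtain ⟨i, -, rfl⟩ := Finset.mem_image.1 h
    simp
  · rintro rfl
    exact Finset.mem_image.2 ⟨x.get, Finset.mem_univ _, List.ofFn_get x⟩

/-- The vertices at distance less than `n` from the root (this is `Λ_{n-1}`, empty for `n = 0`). -/
def below (k n : ℕ) : Finset (Vertex k) := (Finset.range n).biUnion (level k)

/-- `Λ_n`: the vertices at distance at most `n` from the root. -/
def ball (k n : ℕ) : Finset (Vertex k) := below k (n + 1)

/-- `Λ_{[n,n+1]} = W_n ∪ W_{n+1}`. -/
def shell (k n : ℕ) : Finset (Vertex k) := level k n ∪ level k (n + 1)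

/-- The direct successors `S(x)` of a vertex. -/
def succs {k : ℕ} (x : Vertex k) : Finset (Vertex k) :=
  Finset.univ.image (fun i : Fin k => x ++ [i])

/-- The interaction domain `{x} ∪ S(x)`. -/
def fan {k : ℕ} (x : Vertex k) : Finset (Vertex k) := {x} ∪ succs x

theorem mem_below {k n : ℕ} {x : Vertex k} : x ∈ below k n ↔ x.length < n := by
  simp [below, mem_level]

theorem mem_ball {k n : ℕ} {x : Vertex k} : x ∈ ball k n ↔ x.length ≤ n := by
  rw [ball, mem_below, Nat.lt_succ_iff]

theorem mem_shell {k n : ℕ} {x : Vertex k} :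
    x ∈ shell k n ↔ x.length = n ∨ x.length = n + 1 := by
  simp [shell, mem_level]

theorem below_subset_ball (k n : ℕ) : below k n ⊆ ball k n := fun x hx => by
  rw [mem_below] at hx; rw [mem_ball]; omega

theorem ball_subset_ball (k : ℕ) {m n : ℕ} (h : m ≤ n) : ball k m ⊆ ball k n := fun x hx => by
  rw [mem_ball] at hx ⊢; omega

theorem ball_subset_succ (k n : ℕ) : ball k n ⊆ ball k (n + 1) :=
  ball_subset_ball k (Nat.le_succ n)

theorem below_subset_ball_succ (k n : ℕ) : below k n ⊆ ball k (n + 1) :=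
  (below_subset_ball k n).trans (ball_subset_succ k n)

theorem level_subset_ball (k n : ℕ) : level k n ⊆ ball k n := fun x hx => by
  rw [mem_level] at hx; rw [mem_ball]; omega

theorem shell_subset_ball (k n : ℕ) : shell k n ⊆ ball k (n + 1) := fun x hx => by
  rw [mem_shell] at hx; rw [mem_ball]; omega

theorem fan_subset_shell {k n : ℕ} {x : Vertex k} (hx : x ∈ level k n) : fan x ⊆ shell k n := by
  intro y hy
  rw [mem_level] at hx
  rw [mem_shell]
  simp only [fan, succs, Finset.mem_union, Finset.mem_singleton, Finset.mem_image,
    Finset.mem_univ, true_and] at hy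
  rcases hy with rfl | ⟨i, rfl⟩
  · exact Or.inl hx
  · right; simp [hx]

theorem singleton_subset_fan {k : ℕ} (x : Vertex k) : {x} ⊆ fan x := Finset.subset_union_left

theorem singleton_subset_level {k n : ℕ} {x : Vertex k} (hx : x ∈ level k n) :
    {x} ⊆ level k n := Finset.singleton_subset_iff.2 hx

/-! ### Local algebras -/

section Local

variable {V : Type} [DecidableEq V] (d : ℕ)

/-- The local algebra `𝒜_Λ = ⨂_{x ∈ Λ} M_d(ℂ)`, realised as the matrices indexed by the
configurations `Λ → {1, …, d}`. -/
abbrev LocalAlg (Λ : Finset V) : Type := Matrix (Λ → Fin d) (Λ → Fin d) ℂ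

variable {d}

/-- The restriction of a configuration on `Y` to a subset `X`. -/
abbrev restr {X Y : Finset V} (h : X ⊆ Y) (ω : Y → Fin d) : X → Fin d :=
  Finset.restrict₂ (π := fun _ => Fin d) h ω

/-- The inclusion `𝒜_X ≅ 𝒜_X ⊗ 1_{Y \ X} ⊆ 𝒜_Y`. -/
def extend {X Y : Finset V} (h : X ⊆ Y) (a : LocalAlg d X) : LocalAlg d Y :=
  Matrix.of fun ω η =>
    a (restr h ω) (restr h η) *
      (1 : LocalAlg d (Y \ X)) (restr Finset.sdiff_subset ω) (restr Finset.sdiff_subset η)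

/-- The configuration on `Y` equal to `ω` on `X` and to `ζ` on `Y \ X`. -/
def glue {X Y : Finset V} (ω : X → Fin d) (ζ : (Y \ X : Finset V) → Fin d) : Y → Fin d :=
  fun y => if hy : (y : V) ∈ X then ω ⟨y, hy⟩
    else ζ ⟨y, Finset.mem_sdiff.2 ⟨y.2, hy⟩⟩

/-- The partial trace `T^Y_X : 𝒜_Y → 𝒜_X` (for `X ⊆ Y`),
`T^Y_X (a_X ⊗ a_{Y \ X}) = Tr(a_{Y \ X}) a_X`. -/
def partialTrace (X Y : Finset V) (a : LocalAlg d Y) : LocalAlg d X :=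
  Matrix.of fun ω η => ∑ ζ : (Y \ X : Finset V) → Fin d, a (glue ω ζ) (glue η ζ)

/-- The tensor product `⨂_{x ∈ I} a_x ∈ 𝒜_Y` of elements `a_x ∈ 𝒜_{B x}`, where `Y` is the disjoint
union of the `B x`, `x ∈ I`. -/
def tensor {I : Finset V} {B : V → Finset V} {Y : Finset V} (h : ∀ x ∈ I, B x ⊆ Y)
    (a : ∀ x, LocalAlg d (B x)) : LocalAlg d Y :=
  Matrix.of fun ω η => ∏ x : I,
    a x (restr (h x x.2) ω) (restr (h x x.2) η)

end Local

/-! ### The quasi-local algebra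

The algebra `𝒜_V = ⨂_{x ∈ V} M_d(ℂ)` is realised in its faithful representation on `ℓ²` of the set of
all configurations `V → {1, …, d}`, where `a ∈ 𝒜_Λ` acts on the coordinates in `Λ`. Since each
`𝒜_Λ` is a C⋆-algebra, the norm on the local algebra `⋃ 𝒜_Λ` does not depend on the choice of
the faithful representation. -/

section QuasiLocal

variable (V : Type) [DecidableEq V] (d : ℕ)

/-- `ℓ²` over the configurations on the whole of `V`. -/
abbrev ConfigSpace : Type := lp (fun _ : V → Fin d => ℂ) 2

variable {V d}

/-- The exchange `(ω, ξ) ↦ (ω with ξ put on Λ, ω restricted to Λ)`. -/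
def exchange (Λ : Finset V) : (V → Fin d) × (Λ → Fin d) ≃ (V → Fin d) × (Λ → Fin d) where
  toFun p := (Function.updateFinset p.1 Λ p.2, Λ.restrict p.1)
  invFun p := (Function.updateFinset p.1 Λ p.2, Λ.restrict p.1)
  left_inv p := by
    refine Prod.ext ?_ ?_
    · funext x
      by_cases hx : x ∈ Λ <;> simp [Function.updateFinset, hx]
    · funext x
      simp [Function.updateFinset]
  right_inv p := by
    refine Prod.ext ?_ ?_
    · funext x
      by_cases hx : x ∈ Λ <;> simp [Function.updateFinset, hx]
    · funext x
      simp [Function.updateFinset]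

/-- The action of `a ∈ 𝒜_Λ` on functions of configurations. -/
def act {Λ : Finset V} (a : LocalAlg d Λ) (f : (V → Fin d) → ℂ) : (V → Fin d) → ℂ :=
  fun ω => ∑ ξ : Λ → Fin d, a (Λ.restrict ω) ξ * f (Function.updateFinset ω Λ ξ)

set_option linter.unusedSectionVars false in
theorem summable_sq (f : ConfigSpace V d) : Summable fun ω => ‖f ω‖ ^ 2 := by
  have h := (lp.memℓp f).summable (p := 2) (by norm_num)
  simpa using h

theorem summable_exchange (Λ : Finset V) (f : ConfigSpace V d) :
    Summable fun p : (V → Fin d) × (Λ → Fin d) => ‖f (exchange Λ p).1‖ ^ 2 := by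
  have h : Summable fun p : (V → Fin d) × (Λ → Fin d) => ‖f p.1‖ ^ 2 := by
    have := (summable_sq f).mul_of_nonneg ((hasSum_fintype (fun _ : Λ → Fin d =>
      (1 : ℝ))).summable) (fun _ => by positivity) (fun _ => by simp)
    simpa using this
  exact (exchange Λ).summable_iff.2 h

theorem act_sq_le {Λ : Finset V} (a : LocalAlg d Λ) (f : ConfigSpace V d) (ω : V → Fin d) :
    ‖act a f ω‖ ^ 2 ≤ (∑ ξ, ∑ η, ‖a ξ η‖ ^ 2) *
      ∑ ξ : Λ → Fin d, ‖f (Function.updateFinset ω Λ ξ)‖ ^ 2 := by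
  have h1 : ‖act a f ω‖ ≤ ∑ ξ : Λ → Fin d,
      ‖a (Λ.restrict ω) ξ‖ * ‖f (Function.updateFinset ω Λ ξ)‖ := by
    refine (norm_sum_le _ _).trans (le_of_eq ?_)
    simp
  have h2 := Finset.sum_mul_sq_le_sq_mul_sq Finset.univ (fun ξ => ‖a (Λ.restrict ω) ξ‖)
    (fun ξ : Λ → Fin d => ‖f (Function.updateFinset ω Λ ξ)‖)
  have h3 : ∑ ξ, ‖a (Λ.restrict ω) ξ‖ ^ 2 ≤ ∑ ξ, ∑ η, ‖a ξ η‖ ^ 2 :=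
    Finset.single_le_sum (f := fun ξ => ∑ η, ‖a ξ η‖ ^ 2)
      (fun ξ _ => Finset.sum_nonneg fun η _ => by positivity) (Finset.mem_univ (Λ.restrict ω))
  calc ‖act a f ω‖ ^ 2 ≤ (∑ ξ : Λ → Fin d,
      ‖a (Λ.restrict ω) ξ‖ * ‖f (Function.updateFinset ω Λ ξ)‖) ^ 2 := by gcongr
    _ ≤ _ := h2
    _ ≤ _ := by gcongr

theorem summable_fiber (Λ : Finset V) (f : ConfigSpace V d) :
    Summable fun ω => ∑ ξ : Λ → Fin d, ‖f (Function.updateFinset ω Λ ξ)‖ ^ 2 := by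
  have h := (summable_exchange Λ f).prod
  simpa [exchange, tsum_fintype] using h

theorem tsum_fiber (Λ : Finset V) (f : ConfigSpace V d) :
    ∑' ω, ∑ ξ : Λ → Fin d, ‖f (Function.updateFinset ω Λ ξ)‖ ^ 2 =
      (Fintype.card (Λ → Fin d) : ℝ) * ∑' ω, ‖f ω‖ ^ 2 := by
  have h := (summable_exchange Λ f).tsum_prod
  have h0 : Summable fun p : (V → Fin d) × (Λ → Fin d) => ‖f p.1‖ ^ 2 :=
    (exchange Λ).summable_iff.1 (summable_exchange Λ f)
  rw [(exchange Λ).tsum_eq (fun p => ‖f p.1‖ ^ 2), h0.tsum_prod] at h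
  simp only [exchange, Equiv.coe_fn_mk, tsum_fintype, Finset.sum_const, Finset.card_univ,
    nsmul_eq_mul, tsum_mul_left] at h
  exact h.symm

theorem act_mem {Λ : Finset V} (a : LocalAlg d Λ) (f : ConfigSpace V d) :
    Memℓp (act a f) 2 := by
  refine memℓp_gen ?_
  have := Summable.of_nonneg_of_le (fun ω => by positivity) (act_sq_le a f)
    ((summable_fiber Λ f).mul_left _)
  simpa using this

/-- The action of `a ∈ 𝒜_Λ` on `ℓ²`, as a linear map. -/
def actLin {Λ : Finset V} (a : LocalAlg d Λ) : ConfigSpace V d →ₗ[ℂ] ConfigSpace V d where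
  toFun f := ⟨act a f, act_mem a f⟩
  map_add' f g := by
    ext ω
    change act a (fun ω => f ω + g ω) ω = act a f ω + act a g ω
    simp [act, mul_add, Finset.sum_add_distrib]
  map_smul' c f := by
    ext ω
    simp only [act, lp.coeFn_smul, Pi.smul_apply, smul_eq_mul, RingHom.id_apply, Finset.mul_sum]
    exact Finset.sum_congr rfl fun ξ _ => by ring

set_option linter.unusedSectionVars false in
theorem norm_sq_eq (f : ConfigSpace V d) : ‖f‖ ^ 2 = ∑' ω, ‖f ω‖ ^ 2 := by
  have h := lp.norm_rpow_eq_tsum (p := 2) (by norm_num) f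
  simpa using h

theorem actLin_bound {Λ : Finset V} (a : LocalAlg d Λ) (f : ConfigSpace V d) :
    ‖actLin a f‖ ≤
      √((∑ ξ, ∑ η, ‖a ξ η‖ ^ 2) * (Fintype.card (Λ → Fin d) : ℝ)) * ‖f‖ := by
  refine (sq_le_sq₀ (norm_nonneg _) (by positivity)).1 ?_
  rw [mul_pow, Real.sq_sqrt (by positivity), norm_sq_eq, norm_sq_eq f, mul_assoc, ← tsum_fiber,
    ← tsum_mul_left]
  exact (summable_sq (actLin a f)).tsum_le_tsum (act_sq_le a f)
    ((summable_fiber Λ f).mul_left _)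

theorem act_mul {Λ : Finset V} (a b : LocalAlg d Λ) (f : (V → Fin d) → ℂ) :
    act (a * b) f = act a (act b f) := by
  funext ω
  simp only [act, Matrix.mul_apply, Finset.sum_mul, Finset.mul_sum]
  rw [Finset.sum_comm]
  refine Finset.sum_congr rfl fun ξ _ => Finset.sum_congr rfl fun η _ => ?_
  have h1 : Λ.restrict (Function.updateFinset ω Λ ξ) = ξ := by
    funext x; simp [Function.updateFinset]
  have h2 : Function.updateFinset (Function.updateFinset ω Λ ξ) Λ η =
      Function.updateFinset ω Λ η := by
    funext x; by_cases hx : x ∈ Λ <;> simp [Function.updateFinset, hx]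
  rw [h1, h2, mul_assoc]

theorem act_one {Λ : Finset V} (f : (V → Fin d) → ℂ) : act (1 : LocalAlg d Λ) f = f := by
  funext ω
  have h : Function.updateFinset ω Λ (Λ.restrict ω) = ω := by
    funext x; by_cases hx : x ∈ Λ <;> simp [Function.updateFinset, hx]
  simp [act, Matrix.one_apply, h]

/-- The action of `a ∈ 𝒜_Λ` on `ℓ²`, as a bounded operator. -/
noncomputable def actCLM {Λ : Finset V} (a : LocalAlg d Λ) :
    ConfigSpace V d →L[ℂ] ConfigSpace V d :=
  (actLin a).mkContinuous _ (actLin_bound a)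

theorem actCLM_apply {Λ : Finset V} (a : LocalAlg d Λ) (f : ConfigSpace V d) (ω : V → Fin d) :
    actCLM a f ω = ∑ ξ : Λ → Fin d, a (Λ.restrict ω) ξ * f (Function.updateFinset ω Λ ξ) := rfl

theorem summable_inner_act {Λ : Finset V} (a : LocalAlg d Λ) (f g : ConfigSpace V d) :
    Summable fun p : (V → Fin d) × (Λ → Fin d) =>
      star (a (Λ.restrict p.1) p.2 * f (exchange Λ p).1) * g p.1 := by
  have h0 : Summable fun p : (V → Fin d) × (Λ → Fin d) => ‖g p.1‖ ^ 2 :=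
    (exchange Λ).summable_iff.1 (summable_exchange Λ g)
  refine Summable.of_norm_bounded
    (g := fun p => (∑ ξ, ∑ η, ‖a ξ η‖) * (‖f (exchange Λ p).1‖ ^ 2 + ‖g p.1‖ ^ 2))
    (((summable_exchange Λ f).add h0).mul_left _) fun p => ?_
  have h1 : ‖a (Λ.restrict p.1) p.2‖ ≤ ∑ ξ, ∑ η, ‖a ξ η‖ :=
    (Finset.single_le_sum (f := fun η => ‖a (Λ.restrict p.1) η‖) (fun _ _ => norm_nonneg _)
      (Finset.mem_univ p.2)).trans
    (Finset.single_le_sum (f := fun ξ => ∑ η, ‖a ξ η‖)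
      (fun _ _ => Finset.sum_nonneg fun _ _ => norm_nonneg _) (Finset.mem_univ (Λ.restrict p.1)))
  rw [norm_mul, norm_star, norm_mul, mul_assoc]
  refine mul_le_mul h1 ?_ (by positivity) ((norm_nonneg _).trans h1)
  nlinarith [sq_nonneg (‖f (exchange Λ p).1‖ - ‖g p.1‖), sq_nonneg (‖f (exchange Λ p).1‖),
    sq_nonneg (‖g p.1‖)]

theorem inner_actCLM {Λ : Finset V} (a : LocalAlg d Λ) (f g : ConfigSpace V d) :
    inner ℂ (actCLM a f) g = inner ℂ f (actCLM (star a) g) := by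
  have hl : inner ℂ (actCLM a f) g = ∑' p : (V → Fin d) × (Λ → Fin d),
      star (a (Λ.restrict p.1) p.2 * f (exchange Λ p).1) * g p.1 := by
    rw [lp.inner_eq_tsum, (summable_inner_act a f g).tsum_prod]
    refine tsum_congr fun ω => ?_
    rw [tsum_fintype, actCLM_apply]
    simp [exchange, Finset.mul_sum, mul_comm]
  have hr : inner ℂ f (actCLM (star a) g) = ∑' p : (V → Fin d) × (Λ → Fin d),
      star (star ((star a) (Λ.restrict p.1) p.2 * g (exchange Λ p).1) * f p.1) := by
    rw [lp.inner_eq_tsum, ((summable_inner_act (star a) g f).star).tsum_prod]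
    refine tsum_congr fun ω => ?_
    rw [tsum_fintype, actCLM_apply]
    simp [exchange, Finset.mul_sum, mul_comm]
  rw [hl, hr, ← (exchange Λ).tsum_eq]
  refine tsum_congr fun p => ?_
  have h1 : (exchange Λ (exchange Λ p)).1 = p.1 :=
    congrArg Prod.fst ((exchange Λ).left_inv p)
  have h2 : Λ.restrict (exchange Λ p).1 = p.2 :=
    congrArg Prod.snd ((exchange Λ).left_inv p)
  have h3 : (exchange Λ p).2 = Λ.restrict p.1 := rfl
  rw [h1, h2, h3]
  simp [Matrix.star_apply]
  ring

/-- The representation of `𝒜_Λ` on `ℓ²` of the configurations. -/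
noncomputable def localRep (Λ : Finset V) :
    LocalAlg d Λ →⋆ₐ[ℂ] (ConfigSpace V d →L[ℂ] ConfigSpace V d) where
  toFun a := actCLM a
  map_one' := by
    ext f ω
    exact congrFun (act_one (Λ := Λ) f) ω
  map_mul' a b := by
    ext f ω
    exact congrFun (act_mul a b f) ω
  map_zero' := by
    ext f ω
    simp [actCLM_apply]
  map_add' a b := by
    ext f ω
    simp [actCLM_apply, add_mul, Finset.sum_add_distrib]
  commutes' c := by
    ext f ω
    have h : Function.updateFinset ω Λ (Λ.restrict ω) = ω := by
      funext x; by_cases hx : x ∈ Λ <;> simp [Function.updateFinset, hx]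
    simp [actCLM_apply, Matrix.one_apply, h, Algebra.algebraMap_eq_smul_one]
  map_star' a := by
    rw [ContinuousLinearMap.star_eq_adjoint]
    refine (ContinuousLinearMap.eq_adjoint_iff _ _).2 fun f g => ?_
    rw [inner_actCLM, star_star]

variable (V d)

/-- The quasi-local algebra `𝒜_V`: the C⋆-algebra generated by all local algebras. -/
noncomputable def quasiLocalAlg : StarSubalgebra ℂ (ConfigSpace V d →L[ℂ] ConfigSpace V d) :=
  (⨆ Λ : Finset V, (localRep (d := d) Λ).range).topologicalClosure

/-- The elements of the quasi-local algebra. -/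
abbrev QuasiLocal : Type := quasiLocalAlg V d

variable {V d}

/-- The inclusion `𝒜_Λ ⊆ 𝒜_V`. -/
noncomputable def localEmb (Λ : Finset V) : LocalAlg d Λ →⋆ₐ[ℂ] QuasiLocal V d :=
  (localRep Λ).codRestrict (quasiLocalAlg V d) fun a =>
    StarSubalgebra.le_topologicalClosure _
      (le_iSup (fun Λ : Finset V => (localRep (d := d) Λ).range) Λ ⟨a, rfl⟩)

end QuasiLocal

/-! ### States, densities and entropy -/

/-- A state: a normalised positive linear functional. -/
structure IsState {A : Type*} [Ring A] [StarRing A] [Algebra ℂ A] (φ : A →ₗ[ℂ] ℂ) : Prop where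
  map_one : φ 1 = 1
  nonneg : ∀ a : A, 0 ≤ φ (star a * a)

section Entropy

variable {V : Type} [DecidableEq V] {d : ℕ}

/-- The density matrix `D^φ_Λ ∈ 𝒜_Λ` of the restriction of `φ` to `𝒜_Λ`; see `trace_density_mul`. -/
noncomputable def density (φ : QuasiLocal V d →ₗ[ℂ] ℂ) (Λ : Finset V) : LocalAlg d Λ :=
  Matrix.of fun ω η => φ (localEmb Λ (Matrix.single η ω 1))

theorem trace_density_mul (φ : QuasiLocal V d →ₗ[ℂ] ℂ) (Λ : Finset V) (a : LocalAlg d Λ) :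
    (density φ Λ * a).trace = φ (localEmb Λ a) := by
  conv_rhs => rw [Matrix.matrix_eq_sum_single a]
  simp only [Matrix.trace, Matrix.diag_apply, Matrix.mul_apply, density, Matrix.of_apply, map_sum]
  rw [Finset.sum_comm]
  refine Finset.sum_congr rfl fun ω _ => Finset.sum_congr rfl fun η _ => ?_
  have h : Matrix.single ω η (a ω η) = a ω η • Matrix.single ω η (1 : ℂ) := by simp
  rw [h, map_smul, map_smul, smul_eq_mul, mul_comm]

/-- The von Neumann entropy `S(φ|_{𝒜_Λ}) = -Tr(D log D)`, `D = D^φ_Λ`, with `0 log 0 = 0`. -/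
noncomputable def entropy (φ : QuasiLocal V d →ₗ[ℂ] ℂ) (Λ : Finset V) : ℝ :=
  -((density φ Λ * cfc Real.log (density φ Λ)).trace).re

/-- The modulus `|K| = (K K⋆)^{1/2}`, for which `K D K⋆ = D |K|²` whenever `D` commutes with `K`
and `K⋆`. For normal `K` it is also `(K⋆ K)^{1/2}`. -/
noncomputable def modulus {Λ : Finset V} (K : LocalAlg d Λ) : LocalAlg d Λ :=
  cfc Real.sqrt (K * star K)

/-! ### Quantum Markov states -/

/-- A transition expectation: a completely positive identity preserving map `𝒜_Z → 𝒜_Y`. -/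
def IsTransitionExp {Y Z : Finset V} (E : LocalAlg d Z →CP LocalAlg d Y) : Prop := E 1 = 1

/-- A quasi-conditional expectation with respect to `𝒜_X ⊆ 𝒜_Y ⊆ 𝒜_Z`: a completely positive
identity preserving map `E : 𝒜_Z → 𝒜_Y` with `E(ca) = c E(a)` for `c ∈ 𝒜_X`, `a ∈ 𝒜_Z`. -/
structure IsQuasiCondExp {X Y Z : Finset V} (hXY : X ⊆ Y) (hYZ : Y ⊆ Z)
    (E : LocalAlg d Z →CP LocalAlg d Y) : Prop where
  transition : IsTransitionExp E
  map_mul : ∀ (c : LocalAlg d X) (a : LocalAlg d Z),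
    E (extend (hXY.trans hYZ) c * a) = extend hXY c * E a

end Entropy

section Markov

variable {k d : ℕ}

/-- The composition `E_{Λ_0} ∘ E_{Λ_1} ∘ ⋯ ∘ E_{Λ_{n-1}} : 𝒜_{Λ_n} → 𝒜_{Λ_0}`. -/
noncomputable def compose (E : ∀ n, LocalAlg d (ball k (n + 1)) →CP LocalAlg d (ball k n)) :
    ∀ n, LocalAlg d (ball k n) → LocalAlg d (ball k 0)
  | 0 => fun a => a
  | n + 1 => fun a => compose E n (E n a)

/-- `φ` is the quantum Markov chain defined by the initial state `φ₀` on `𝒜_{Λ_0}`, the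
quasi-conditional expectations `E_{Λ_n}` with respect to `𝒜_{Λ_{n-1}} ⊆ 𝒜_{Λ_n} ⊆ 𝒜_{Λ_{n+1}}` and
the positive boundary conditions `h_n ∈ 𝒜_{Λ_n}`: it is a state with
`φ(a) = lim_n φ₀ ∘ E_{Λ_0} ∘ ⋯ ∘ E_{Λ_n} (h_{n+1}^{1/2} a h_{n+1}^{1/2})` for every local `a`. For
`a ∈ 𝒜_{Λ_m}` the sequence is indexed by `j`, where `n = m + j`. -/
structure IsQuantumMarkovChain (φ : QuasiLocal (Vertex k) d →ₗ[ℂ] ℂ)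
    (φ₀ : LocalAlg d (ball k 0) →ₗ[ℂ] ℂ)
    (E : ∀ n, LocalAlg d (ball k (n + 1)) →CP LocalAlg d (ball k n))
    (h : ∀ n, LocalAlg d (ball k n)) : Prop where
  state : IsState φ
  init : IsState φ₀
  quasi : ∀ n, IsQuasiCondExp (below_subset_ball k n) (ball_subset_succ k n) (E n)
  boundary : ∀ n, 0 ≤ h n
  limit : ∀ (m : ℕ) (a : LocalAlg d (ball k m)), Filter.Tendsto
    (fun j : ℕ => φ₀ (compose E (m + j + 1)
      (cfc Real.sqrt (h (m + j + 1)) *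
        extend (ball_subset_ball k (by omega : m ≤ m + j + 1)) a *
        cfc Real.sqrt (h (m + j + 1)))))
    Filter.atTop (𝓝 (φ (localEmb (ball k m) a)))

/-- `φ` is a quantum Markov state with sequence of quasi-conditional expectations `E_{Λ_n}`: a quantum
Markov chain with `φ|_{𝒜_{Λ_n}} ∘ E_{Λ_n} = φ|_{𝒜_{Λ_{n+1}}}` for every `n`. -/
def IsQuantumMarkovState (φ : QuasiLocal (Vertex k) d →ₗ[ℂ] ℂ)
    (E : ∀ n, LocalAlg d (ball k (n + 1)) →CP LocalAlg d (ball k n)) : Prop :=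
  (∃ φ₀ h, IsQuantumMarkovChain φ φ₀ E h) ∧
    ∀ (n : ℕ) (a : LocalAlg d (ball k (n + 1))),
      φ (localEmb (ball k n) (E n a)) = φ (localEmb (ball k (n + 1)) a)

/-- `E_{Λ_n} = id_{Λ_{n-1}} ⊗ ℰ_{W_n}` with a transition expectation
`ℰ_{W_n} = ⨂_{x ∈ W_n} ℰ_x : 𝒜_{Λ_{[n,n+1]}} → 𝒜_{W_n}`. -/
def IsLocalized {n : ℕ} (E : LocalAlg d (ball k (n + 1)) →CP LocalAlg d (ball k n))
    (ℰ : ∀ x : Vertex k, LocalAlg d (fan x) →CP LocalAlg d {x}) : Prop :=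
  ∃ F : LocalAlg d (shell k n) →CP LocalAlg d (level k n), IsTransitionExp F ∧
    (∀ (c : LocalAlg d (below k n)) (a : LocalAlg d (shell k n)),
      E (extend (below_subset_ball_succ k n) c * extend (shell_subset_ball k n) a) =
        extend (below_subset_ball k n) c * extend (level_subset_ball k n) (F a)) ∧
    ∀ a : ∀ x : Vertex k, LocalAlg d (fan x),
      F (tensor (fun _ => fan_subset_shell) a) =
        tensor (fun _ => singleton_subset_level) (fun x => ℰ x (a x))

/-- `K ∈ 𝒜_{{x} ∪ S(x)}` is a conditional density amplitude of `ℰ_x`: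
`ℰ_x(a) = T_{x}^{{x} ∪ S(x)} (K⋆ a K)`. -/
def IsAmplitude {x : Vertex k} (ℰ : LocalAlg d (fan x) →CP LocalAlg d {x})
    (K : LocalAlg d (fan x)) : Prop :=
  ∀ a : LocalAlg d (fan x), ℰ a = partialTrace {x} (fan x) (star K * a * K)

/-- `K_{[n,n+1]} = ⨂_{x ∈ W_n} K_{{x} ∪ S(x)} ∈ 𝒜_{Λ_{[n,n+1]}}`. -/
def levelAmplitude (n : ℕ) (K : ∀ x : Vertex k, LocalAlg d (fan x)) : LocalAlg d (shell k n) :=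
  tensor (fun _ => fan_subset_shell) K

end Markov

end CayleyQMS

/-!
The entropy identity. Let `Y` be the disjoint union of `X` and `Z`. Then `S(Z) - S(Y)` is the
relative entropy `Tr D_Y (log D_Y - log (1 ⊗ D_Z))`. The functional `Tr_X ⊗ φ|_Z` with density
`1 ⊗ D_Z` is the average `x ↦ ∑ φ(e_ij x e_ji)` over the matrix units of `𝒜_X`
(`trace_extend_density_mul`), so every bimodule map over `𝒜_X` that leaves `φ` invariant also
leaves this functional invariant. With `X = Λ_{n-1}`, both `E_{Λ_n} : 𝒜_{Λ_{n+1}} → 𝒜_{Λ_n}` and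
the inclusion `𝒜_{Λ_n} ⊆ 𝒜_{Λ_{n+1}}` are such maps. Monotonicity of the relative entropy under
the first gives one inequality between the conditional entropies, and under the second the other
one, which is strong subadditivity (`entropy_sub_entropy_le`, `entropy_add_entropy`).

Monotonicity of the relative entropy (`relativeEntropy_mono`) has a short proof for unital maps
`F` satisfying the Schwarz inequality `F(x)⋆ F(x) ≤ F(x⋆ x)`, which holds for completely positive
unital maps (`cp_schwarz`). For `s > 0` the quadratic form `2 Re Tr(ρ X) - Tr(σ X X⋆) - s Tr(ρ X⋆
X)` has the maximum `∑ p_i² |⟨u_i, v_j⟩|² / (q_j + s p_i)`, where `p_i, u_i` and `q_j, v_j` are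
the eigenvalues and eigenvectors of `ρ` and `σ`. The Schwarz inequality shows at once that the
maximum does not increase under the dual of `F`. Integrating over `s` turns the resolvents into
logarithms (`sum_mul_log_le_of_resolvent`) and the maxima into the relative entropy.

The entropy increment. On matrix units one checks that `D_{n+1} = K D_n K⋆` (`density_succ`),
which is `D_n (K K⋆)` as `K` commutes with `D_n`. For commuting Hermitian matrices `A B log(A B) =
A B log A + A B log B`, where the factor `A B` absorbs the convention `log 0 = 0`
(`mul_cfc_log_mul`). Applied to `D_n` and `K K⋆`, and then to the tensor factors of `K K⋆ = ⨂ K_x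
K_x⋆` (`IsPartition.tensor_mul_cfc_log`), this gives the formula, with `log (K_x K_x⋆) = 2 log
|K_x|`.
-/

namespace CayleyQMS

/-! ### Monotonicity of the relative entropy -/

/-- Integrating an inequality between sums of resolvents over `s ∈ (0, ∞)` gives the inequality
between the corresponding sums of logarithms. -/
theorem sum_mul_log_le_of_resolvent {ι κ : Type*} [Fintype ι] [Fintype κ]
    {c r : ι → ℝ} {c' r' : κ → ℝ} (hr : ∀ i, 0 < r i) (hr' : ∀ j, 0 < r' j)
    (hsum : ∑ i, c i = ∑ j, c' j)
    (h : ∀ s : ℝ, 0 < s → ∑ j, c' j / (s + r' j) ≤ ∑ i, c i / (s + r i)) :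
    ∑ i, c i * Real.log (r i) ≤ ∑ j, c' j * Real.log (r' j) := by
  set g : ℝ → ℝ := fun s =>
    ∑ i, c i * Real.log (s + r i) - ∑ j, c' j * Real.log (s + r' j) with hg
  have hderiv : ∀ s : ℝ, 0 ≤ s →
      HasDerivAt g (∑ i, c i / (s + r i) - ∑ j, c' j / (s + r' j)) s := by
    intro s hs
    refine HasDerivAt.sub (HasDerivAt.fun_sum fun i _ => ?_) (HasDerivAt.fun_sum fun j _ => ?_)
    · have h0 : s + r i ≠ 0 := (add_pos_of_nonneg_of_pos hs (hr i)).ne'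
      have := (((hasDerivAt_id s).add_const (r i)).log h0).const_mul (c i)
      simpa [div_eq_mul_inv] using this
    · have h0 : s + r' j ≠ 0 := (add_pos_of_nonneg_of_pos hs (hr' j)).ne'
      have := (((hasDerivAt_id s).add_const (r' j)).log h0).const_mul (c' j)
      simpa [div_eq_mul_inv] using this
  -- `g` increases to `0`, so `g 0 ≤ 0`, which is the claim.
  have hmono : MonotoneOn g (Set.Ici 0) := by
    refine monotoneOn_of_deriv_nonneg (convex_Ici 0)
      (fun s hs => (hderiv s hs).continuousAt.continuousWithinAt) ?_ ?_
    · intro s hs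
      rw [interior_Ici] at hs
      exact (hderiv s (le_of_lt hs)).differentiableAt.differentiableWithinAt
    · intro s hs
      rw [interior_Ici] at hs
      rw [(hderiv s (le_of_lt hs)).deriv, sub_nonneg]
      exact h s hs
  have hlim : Filter.Tendsto g Filter.atTop (𝓝 0) := by
    have key : ∀ s, g s = ∑ i, c i * (Real.log (s + r i) - Real.log s) -
        ∑ j, c' j * (Real.log (s + r' j) - Real.log s) := by
      intro s
      simp only [hg, mul_sub, Finset.sum_sub_distrib, ← Finset.sum_mul, hsum]
      ring
    have h1 : Filter.Tendsto (fun s : ℝ => ∑ i, c i * (Real.log (s + r i) - Real.log s) -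
        ∑ j, c' j * (Real.log (s + r' j) - Real.log s)) Filter.atTop
        (𝓝 (∑ i, c i * 0 - ∑ j, c' j * 0)) :=
      (tendsto_finsetSum _ fun i _ => (Real.tendsto_log_comp_add_sub_log (r i)).const_mul _).sub
        (tendsto_finsetSum _ fun j _ => (Real.tendsto_log_comp_add_sub_log (r' j)).const_mul _)
    simpa [funext key] using h1
  have h0 : g 0 ≤ 0 := ge_of_tendsto hlim <| by
    filter_upwards [Filter.eventually_ge_atTop (0 : ℝ)] with s hs
    exact hmono (by simp) hs hs
  simpa [hg] using h0

section Matrix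

variable {m n : Type*} [Fintype m] [DecidableEq m] [Fintype n] [DecidableEq n]

/-- The transition matrix `⟨u_i, v_j⟩` between the eigenbases of two Hermitian matrices. -/
noncomputable def eigenTransition {ρ σ : Matrix n n ℂ} (hρ : ρ.IsHermitian) (hσ : σ.IsHermitian) :
    Matrix n n ℂ :=
  star (hρ.eigenvectorUnitary : Matrix n n ℂ) * (hσ.eigenvectorUnitary : Matrix n n ℂ)

theorem cfc_eq_conj {ρ : Matrix n n ℂ} (hρ : ρ.IsHermitian) (f : ℝ → ℝ) :
    cfc f ρ = (hρ.eigenvectorUnitary : Matrix n n ℂ) *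
      Matrix.diagonal (fun i => ((f (hρ.eigenvalues i) : ℝ) : ℂ)) *
      star (hρ.eigenvectorUnitary : Matrix n n ℂ) := by
  rw [hρ.cfc_eq, Matrix.IsHermitian.cfc, Unitary.conjStarAlgAut_apply]
  rfl

theorem trace_cfc_mul_cfc {ρ σ : Matrix n n ℂ} (hρ : ρ.IsHermitian) (hσ : σ.IsHermitian)
    (f g : ℝ → ℝ) :
    (cfc f ρ * cfc g σ).trace = ∑ p : n × n, ((f (hρ.eigenvalues p.1) * g (hσ.eigenvalues p.2) *
      Complex.normSq (eigenTransition hρ hσ p.1 p.2) : ℝ) : ℂ) := by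
  rw [cfc_eq_conj hρ, cfc_eq_conj hσ]
  set U := (hρ.eigenvectorUnitary : Matrix n n ℂ)
  set V := (hσ.eigenvectorUnitary : Matrix n n ℂ)
  set P := Matrix.diagonal (fun i => ((f (hρ.eigenvalues i) : ℝ) : ℂ))
  set Q := Matrix.diagonal (fun i => ((g (hσ.eigenvalues i) : ℝ) : ℂ))
  have : U * P * star U * (V * Q * star V) =
      U * (P * (eigenTransition hρ hσ * (Q * star V))) := by
    simp only [eigenTransition, Matrix.mul_assoc, U, V]
  rw [this, Matrix.trace_mul_comm]
  have h2 : P * (eigenTransition hρ hσ * (Q * star V)) * U =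
      P * (eigenTransition hρ hσ * (Q * star (eigenTransition hρ hσ))) := by
    simp only [eigenTransition, Matrix.mul_assoc, U, V, star_mul, star_star]
  rw [h2, Fintype.sum_prod_type]
  simp only [Matrix.trace, Matrix.diag_apply, P, Q, Matrix.diagonal_mul]
  refine Finset.sum_congr rfl fun i _ => ?_
  rw [Matrix.mul_apply, Finset.mul_sum]
  refine Finset.sum_congr rfl fun j _ => ?_
  rw [Matrix.diagonal_mul, Matrix.star_apply]
  push_cast
  rw [← Complex.mul_conj]
  simp only [Complex.star_def]
  ring

/-- The quadratic form whose supremum over `X` is `Tr ρ (L_σ + s R_ρ)⁻¹ ρ`, with `L` and `R` the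
left and right multiplications. The relative entropy is the integral over `s ∈ (0, ∞)` of these
suprema less `Tr ρ / (1 + s)`. -/
noncomputable def resolventForm (ρ σ : Matrix n n ℂ) (s : ℝ) (X : Matrix n n ℂ) : ℝ :=
  2 * (ρ * X).trace.re - (σ * (X * star X)).trace.re - s * (ρ * (star X * X)).trace.re

theorem resolventForm_eq {ρ σ : Matrix n n ℂ} (hρ : ρ.IsHermitian) (hσ : σ.IsHermitian) (s : ℝ)
    (Y : Matrix n n ℂ) :
    resolventForm ρ σ s ((hσ.eigenvectorUnitary : Matrix n n ℂ) * Y *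
        star (hρ.eigenvectorUnitary : Matrix n n ℂ)) =
      ∑ p : n × n, (2 * (hρ.eigenvalues p.1 * (eigenTransition hρ hσ p.1 p.2 * Y p.2 p.1).re) -
        (hσ.eigenvalues p.2 + s * hρ.eigenvalues p.1) * Complex.normSq (Y p.2 p.1)) := by
  have e1 : ρ = (hρ.eigenvectorUnitary : Matrix n n ℂ) *
      Matrix.diagonal (fun i => ((hρ.eigenvalues i : ℝ) : ℂ)) *
      star (hρ.eigenvectorUnitary : Matrix n n ℂ) := by
    have := cfc_eq_conj hρ id
    rwa [cfc_id ℝ ρ hρ.isSelfAdjoint] at this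
  have e2 : σ = (hσ.eigenvectorUnitary : Matrix n n ℂ) *
      Matrix.diagonal (fun i => ((hσ.eigenvalues i : ℝ) : ℂ)) *
      star (hσ.eigenvectorUnitary : Matrix n n ℂ) := by
    have := cfc_eq_conj hσ id
    rwa [cfc_id ℝ σ hσ.isSelfAdjoint] at this
  set U := (hρ.eigenvectorUnitary : Matrix n n ℂ) with hU
  set V := (hσ.eigenvectorUnitary : Matrix n n ℂ) with hV
  set P := Matrix.diagonal (fun i => ((hρ.eigenvalues i : ℝ) : ℂ)) with hP
  set Q := Matrix.diagonal (fun i => ((hσ.eigenvalues i : ℝ) : ℂ)) with hQ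
  have uU : star U * U = 1 := by simp [hU]
  have uV : star V * V = 1 := by simp [hV]
  have uU' (A : Matrix n n ℂ) : star U * (U * A) = A := by rw [← Matrix.mul_assoc, uU, one_mul]
  have uV' (A : Matrix n n ℂ) : star V * (V * A) = A := by rw [← Matrix.mul_assoc, uV, one_mul]
  have t1 : (ρ * (V * Y * star U)).trace = (P * (eigenTransition hρ hσ * Y)).trace := by
    refine (congrArg (fun r => (r * (V * Y * star U)).trace) e1).trans ?_
    simp only [eigenTransition, ← hU, ← hV, Matrix.mul_assoc]
    rw [Matrix.trace_mul_comm]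
    simp only [Matrix.mul_assoc, uU, mul_one]
  have t2 : (σ * (V * Y * star U * star (V * Y * star U))).trace = (Q * (Y * star Y)).trace := by
    refine (congrArg (fun r => (r * (V * Y * star U * star (V * Y * star U))).trace) e2).trans ?_
    simp only [star_mul, star_star, Matrix.mul_assoc, uU', uV']
    rw [Matrix.trace_mul_comm]
    simp only [Matrix.mul_assoc, uV, mul_one]
  have t3 : (ρ * (star (V * Y * star U) * (V * Y * star U))).trace = (P * (star Y * Y)).trace := by
    refine (congrArg (fun r => (r * (star (V * Y * star U) * (V * Y * star U))).trace) e1).trans ?_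
    simp only [star_mul, star_star, Matrix.mul_assoc, uU', uV']
    rw [Matrix.trace_mul_comm]
    simp only [Matrix.mul_assoc, uU, mul_one]
  rw [resolventForm, t1, t2, t3]
  have mP (A : Matrix n n ℂ) (i j : n) : (P * A) i j = (hρ.eigenvalues i : ℂ) * A i j :=
    Matrix.diagonal_mul ..
  have mQ (A : Matrix n n ℂ) (i j : n) : (Q * A) i j = (hσ.eigenvalues i : ℂ) * A i j :=
    Matrix.diagonal_mul ..
  have s1 : (P * (eigenTransition hρ hσ * Y)).trace.re = ∑ p : n × n,
      hρ.eigenvalues p.1 * (eigenTransition hρ hσ p.1 p.2 * Y p.2 p.1).re := by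
    simp only [Matrix.trace, Matrix.diag_apply, mP, Fintype.sum_prod_type, Complex.re_sum,
      Complex.re_ofReal_mul]
    simp only [Matrix.mul_apply, Finset.mul_sum, Complex.re_sum]
  have s2 : (Q * (Y * star Y)).trace.re = ∑ p : n × n,
      hσ.eigenvalues p.2 * Complex.normSq (Y p.2 p.1) := by
    rw [Fintype.sum_prod_type_right]
    simp only [Matrix.trace, Matrix.diag_apply, mQ, Complex.re_sum, Complex.re_ofReal_mul]
    simp only [Matrix.mul_apply, Finset.mul_sum, Complex.re_sum, Matrix.star_apply,
      Complex.star_def, Complex.mul_conj, Complex.ofReal_re]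
  have s3 : (P * (star Y * Y)).trace.re = ∑ p : n × n,
      hρ.eigenvalues p.1 * Complex.normSq (Y p.2 p.1) := by
    rw [Fintype.sum_prod_type]
    simp only [Matrix.trace, Matrix.diag_apply, mP, Complex.re_sum, Complex.re_ofReal_mul]
    simp only [Matrix.mul_apply, Finset.mul_sum, Complex.re_sum, Matrix.star_apply,
      Complex.star_def, mul_comm ((starRingEnd ℂ) _), Complex.mul_conj, Complex.ofReal_re]
  rw [s1, s2, s3, Finset.mul_sum, Finset.mul_sum, ← Finset.sum_sub_distrib,
    ← Finset.sum_sub_distrib]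
  exact Finset.sum_congr rfl fun p _ => by ring

/-- The maximum of the resolvent form, in terms of eigenvalues. -/
noncomputable def resolventSum {ρ σ : Matrix n n ℂ} (hρ : ρ.IsHermitian) (hσ : σ.IsHermitian)
    (s : ℝ) : ℝ :=
  ∑ p : n × n, hρ.eigenvalues p.1 ^ 2 * Complex.normSq (eigenTransition hρ hσ p.1 p.2) /
    (hσ.eigenvalues p.2 + s * hρ.eigenvalues p.1)

theorem resolventForm_le {ρ σ : Matrix n n ℂ} (hρ : ρ.PosSemidef) (hσ : σ.PosSemidef) {s : ℝ}
    (hs : 0 < s) (X : Matrix n n ℂ) :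
    resolventForm ρ σ s X ≤ resolventSum hρ.isHermitian hσ.isHermitian s := by
  set Y := star (hσ.isHermitian.eigenvectorUnitary : Matrix n n ℂ) * X *
    (hρ.isHermitian.eigenvectorUnitary : Matrix n n ℂ) with hY
  have hX : X = (hσ.isHermitian.eigenvectorUnitary : Matrix n n ℂ) * Y *
      star (hρ.isHermitian.eigenvectorUnitary : Matrix n n ℂ) := by
    have hu {τ : Matrix n n ℂ} (hτ : τ.IsHermitian) : (hτ.eigenvectorUnitary : Matrix n n ℂ) *
        star (hτ.eigenvectorUnitary : Matrix n n ℂ) = 1 := by simp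
    rw [hY, Matrix.mul_assoc _ _ (star _), Matrix.mul_assoc _ _ (star _), hu, mul_one,
      ← Matrix.mul_assoc, hu, one_mul]
  rw [hX, resolventForm_eq, resolventSum]
  refine Finset.sum_le_sum fun p _ => ?_
  have hp := hρ.eigenvalues_nonneg p.1
  have hq := hσ.eigenvalues_nonneg p.2
  generalize hρ.isHermitian.eigenvalues p.1 = a at hp ⊢
  generalize hσ.isHermitian.eigenvalues p.2 = b at hq ⊢
  generalize eigenTransition hρ.isHermitian hσ.isHermitian p.1 p.2 = w
  generalize Y p.2 p.1 = y
  rcases (by positivity : 0 ≤ b + s * a).eq_or_lt with h0 | h0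
  · have ha : a = 0 := by nlinarith [mul_nonneg hs.le hp]
    rw [← h0]
    simp [ha]
  · rw [le_div_iff₀ h0]
    have := Complex.normSq_nonneg (((b + s * a : ℝ) : ℂ) * y - (a : ℂ) * (starRingEnd ℂ) w)
    rw [Complex.normSq_apply] at this
    simp only [Complex.sub_re, Complex.sub_im, Complex.re_ofReal_mul, Complex.im_ofReal_mul,
      Complex.conj_re, Complex.conj_im] at this
    rw [Complex.normSq_apply, Complex.normSq_apply, Complex.mul_re]
    nlinarith

theorem exists_resolventForm_eq {ρ σ : Matrix n n ℂ} (hρ : ρ.PosSemidef) (hσ : σ.PosSemidef)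
    {s : ℝ} (hs : 0 < s) :
    ∃ X, resolventForm ρ σ s X = resolventSum hρ.isHermitian hσ.isHermitian s := by
  -- The maximiser has the entries `p_i conj(w_ij) / (q_j + s p_i)` in the two eigenbases.
  refine ⟨_, (resolventForm_eq hρ.isHermitian hσ.isHermitian s (Matrix.of fun j i =>
    ((hρ.isHermitian.eigenvalues i / (hσ.isHermitian.eigenvalues j +
      s * hρ.isHermitian.eigenvalues i) : ℝ) : ℂ) *
      (starRingEnd ℂ) (eigenTransition hρ.isHermitian hσ.isHermitian i j))).trans ?_⟩
  rw [resolventSum]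
  refine Finset.sum_congr rfl fun p _ => ?_
  have hp := hρ.eigenvalues_nonneg p.1
  have hq := hσ.eigenvalues_nonneg p.2
  rw [Matrix.of_apply]
  generalize hρ.isHermitian.eigenvalues p.1 = a at hp ⊢
  generalize hσ.isHermitian.eigenvalues p.2 = b at hq ⊢
  generalize eigenTransition hρ.isHermitian hσ.isHermitian p.1 p.2 = w
  rcases (by positivity : 0 ≤ b + s * a).eq_or_lt with h0 | h0
  · rw [← h0]
    simp
  · rw [mul_left_comm w, Complex.mul_conj, Complex.normSq_mul, Complex.normSq_ofReal,
      Complex.normSq_conj, ← Complex.ofReal_mul, Complex.ofReal_re]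
    field_simp
    ring

theorem trace_mul_nonneg {ρ a : Matrix n n ℂ} (hρ : ρ.PosSemidef) (ha : 0 ≤ a) :
    0 ≤ (ρ * a).trace := by
  obtain ⟨b, rfl⟩ := CStarAlgebra.nonneg_iff_eq_star_mul_self.1 ha
  rw [← Matrix.mul_assoc, Matrix.trace_mul_comm, ← Matrix.mul_assoc]
  exact (hρ.mul_mul_conjTranspose_same b).trace_nonneg

theorem trace_mul_re_mono {ρ a b : Matrix n n ℂ} (hρ : ρ.PosSemidef) (h : a ≤ b) :
    (ρ * a).trace.re ≤ (ρ * b).trace.re := by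
  have := (Complex.le_def.1 (trace_mul_nonneg hρ (sub_nonneg.2 h))).1
  rw [mul_sub, Matrix.trace_sub, Complex.sub_re] at this
  simpa using this

/-- If the kernel of `σ` is contained in that of `ρ`, then the pairs of eigenvectors `(u_i, v_j)`
with `q_j = 0` carry no weight `p_i |⟨u_i, v_j⟩|²`. -/
theorem eigenvalue_mul_normSq_eq_zero {ρ σ : Matrix n n ℂ} (hρ : ρ.IsHermitian)
    (hσ : σ.IsHermitian) (hsupp : ∀ v : n → ℂ, σ.mulVec v = 0 → ρ.mulVec v = 0) {i j : n}
    (hj : hσ.eigenvalues j = 0) :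
    hρ.eigenvalues i * Complex.normSq (eigenTransition hρ hσ i j) = 0 := by
  have h1 : ρ.mulVec (hσ.eigenvectorBasis j) = 0 := by
    refine hsupp _ ?_
    rw [hσ.mulVec_eigenvectorBasis, hj]
    simp
  have e1 : star (hρ.eigenvectorUnitary : Matrix n n ℂ) * ρ =
      Matrix.diagonal (fun i => ((hρ.eigenvalues i : ℝ) : ℂ)) *
      star (hρ.eigenvectorUnitary : Matrix n n ℂ) := by
    have := cfc_eq_conj hρ id
    rw [cfc_id ℝ ρ hρ.isSelfAdjoint] at this
    refine (congrArg (fun r => star (hρ.eigenvectorUnitary : Matrix n n ℂ) * r) this).trans ?_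
    rw [Matrix.mul_assoc (hρ.eigenvectorUnitary : Matrix n n ℂ), ← Matrix.mul_assoc]
    simp
  have h2 : ((hρ.eigenvalues i : ℝ) : ℂ) * eigenTransition hρ hσ i j = 0 := by
    have h3 : (Matrix.diagonal (fun i => ((hρ.eigenvalues i : ℝ) : ℂ)) *
        eigenTransition hρ hσ) i j = 0 := by
      rw [eigenTransition, ← Matrix.mul_assoc, ← e1, Matrix.mul_assoc, Matrix.mul_apply]
      refine Finset.sum_eq_zero fun l _ => ?_
      have : (ρ * (hσ.eigenvectorUnitary : Matrix n n ℂ)) l j = 0 := by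
        have := congrFun h1 l
        simpa [Matrix.mulVec, dotProduct, Matrix.mul_apply,
          Matrix.IsHermitian.eigenvectorUnitary_apply] using this
      rw [this, mul_zero]
    rwa [Matrix.diagonal_mul] at h3
  rcases mul_eq_zero.1 h2 with h | h
  · rw [Complex.ofReal_eq_zero.1 h, zero_mul]
  · rw [h]; simp

theorem cfc_const_one_matrix (ρ : Matrix n n ℂ) (hρ : ρ.IsHermitian) :
    cfc (fun _ : ℝ => (1 : ℝ)) ρ = 1 :=
  cfc_const_one ℝ ρ hρ.isSelfAdjoint

/-- The relative entropy is `-∑ c log r` and the resolvent form has maximum `∑ c / (s + r)`, for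
the same weights `c` and the same ratios `r` of eigenvalues. -/
theorem exists_spectral_weights {ρ σ : Matrix n n ℂ} (hρ : ρ.PosSemidef) (hσ : σ.PosSemidef)
    (hsupp : ∀ v : n → ℂ, σ.mulVec v = 0 → ρ.mulVec v = 0) :
    ∃ c r : n × n → ℝ, (∀ p, 0 < r p) ∧ ∑ p, c p = ρ.trace.re ∧
      (∀ s, resolventSum hρ.isHermitian hσ.isHermitian s = ∑ p, c p / (s + r p)) ∧
      (ρ * cfc Real.log ρ).trace.re - (ρ * cfc Real.log σ).trace.re =
        -∑ p, c p * Real.log (r p) := by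
  have hρ' := hρ.isHermitian
  have hσ' := hσ.isHermitian
  have hid : cfc (fun x : ℝ => x) ρ = ρ := cfc_id' ℝ ρ hρ'.isSelfAdjoint
  have hmul : ρ * cfc Real.log ρ = cfc (fun x : ℝ => x * Real.log x) ρ := by
    have := ρ.finite_real_spectrum
    rw [cfc_mul (fun x : ℝ => x) Real.log ρ (this.continuousOn _) (this.continuousOn _), hid]
  have h1 := trace_cfc_mul_cfc hρ' hσ' (fun x => x) (fun _ => 1)
  have h2 := trace_cfc_mul_cfc hρ' hσ' (fun x => x * Real.log x) (fun _ => 1)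
  have h3 := trace_cfc_mul_cfc hρ' hσ' (fun x => x) Real.log
  rw [cfc_const_one_matrix σ hσ', mul_one, hid] at h1
  rw [cfc_const_one_matrix σ hσ', mul_one, ← hmul] at h2
  rw [hid] at h3
  set c : n × n → ℝ := fun p =>
    hρ'.eigenvalues p.1 * Complex.normSq (eigenTransition hρ' hσ' p.1 p.2) with hc
  -- The ratio is irrelevant where the weight vanishes; `1` keeps it positive there.
  set r : n × n → ℝ := fun p =>
    if c p = 0 then 1 else hσ'.eigenvalues p.2 / hρ'.eigenvalues p.1 with hr
  have hpos : ∀ p, c p ≠ 0 → 0 < hρ'.eigenvalues p.1 ∧ 0 < hσ'.eigenvalues p.2 := by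
    intro p hp
    refine ⟨(hρ.eigenvalues_nonneg _).lt_of_ne fun h => hp (by rw [hc]; simp [← h]),
      (hσ.eigenvalues_nonneg _).lt_of_ne fun h => hp ?_⟩
    exact eigenvalue_mul_normSq_eq_zero hρ' hσ' hsupp h.symm
  refine ⟨c, r, fun p => ?_, ?_, fun s => ?_, ?_⟩
  · by_cases hp : c p = 0
    · simp [hr, hp]
    · simpa [hr, hp] using div_pos (hpos p hp).2 (hpos p hp).1
  · rw [h1, ← Complex.ofReal_sum, Complex.ofReal_re]
    simp [hc]
  · refine Finset.sum_congr rfl fun p _ => ?_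
    by_cases hp : c p = 0
    · have : hρ'.eigenvalues p.1 ^ 2 * Complex.normSq (eigenTransition hρ' hσ' p.1 p.2) = 0 := by
        rw [sq, mul_assoc]
        exact mul_eq_zero_of_right _ hp
      rw [this, hp, zero_div, zero_div]
    · have h0 := (hpos p hp).1
      have e : hσ'.eigenvalues p.2 + s * hρ'.eigenvalues p.1 =
          hρ'.eigenvalues p.1 * (s + r p) := by
        simp only [hr, hp, if_false]
        field_simp
        ring
      rw [e, sq, mul_assoc, mul_div_mul_left _ _ h0.ne']
  · rw [h2, h3, ← Complex.ofReal_sum, ← Complex.ofReal_sum, Complex.ofReal_re, Complex.ofReal_re,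
      ← Finset.sum_sub_distrib, ← Finset.sum_neg_distrib]
    refine Finset.sum_congr rfl fun p _ => ?_
    by_cases hp : c p = 0
    · rcases mul_eq_zero.1 hp with h | h
      · simp [h, hp]
      · simp [h, hp]
    · have := hpos p hp
      simp only [hr, hp, if_false, Real.log_div this.2.ne' this.1.ne']
      simp only [hc]
      ring

/-- The relative entropy `Tr ρ (log ρ - log σ)` decreases when `ρ` and `σ` are composed with a
unital map satisfying the Schwarz inequality: here `Tr(ρ' x) = Tr(ρ F(x))` and
`Tr(σ' x) = Tr(σ F(x))`. -/
theorem relativeEntropy_mono {ρ σ : Matrix m m ℂ} {ρ' σ' : Matrix n n ℂ}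
    (hρ : ρ.PosSemidef) (hσ : σ.PosSemidef) (hρ' : ρ'.PosSemidef) (hσ' : σ'.PosSemidef)
    (hsupp : ∀ v : m → ℂ, σ.mulVec v = 0 → ρ.mulVec v = 0)
    (hsupp' : ∀ v : n → ℂ, σ'.mulVec v = 0 → ρ'.mulVec v = 0)
    (F : Matrix n n ℂ → Matrix m m ℂ) (hone : F 1 = 1) (hstar : ∀ x, F (star x) = star (F x))
    (hF : ∀ x, star (F x) * F x ≤ F (star x * x))
    (hFρ : ∀ x, (ρ' * x).trace = (ρ * F x).trace)
    (hFσ : ∀ x, (σ' * x).trace = (σ * F x).trace) :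
    (ρ' * cfc Real.log ρ').trace.re - (ρ' * cfc Real.log σ').trace.re ≤
      (ρ * cfc Real.log ρ).trace.re - (ρ * cfc Real.log σ).trace.re := by
  obtain ⟨c, r, hr, hc, hR, hS⟩ := exists_spectral_weights hρ hσ hsupp
  obtain ⟨c', r', hr', hc', hR', hS'⟩ := exists_spectral_weights hρ' hσ' hsupp'
  rw [hS, hS', neg_le_neg_iff]
  have htr : ∑ p, c p = ∑ p, c' p := by
    have := hFρ 1
    rw [hone, mul_one, mul_one] at this
    rw [hc, hc', this]
  refine sum_mul_log_le_of_resolvent hr hr' htr fun s hs => ?_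
  rw [← hR, ← hR']
  obtain ⟨X, hX⟩ := exists_resolventForm_eq hρ' hσ' hs
  rw [← hX]
  refine le_trans ?_ (resolventForm_le hρ hσ hs (F X))
  have h1 : (σ * (F X * star (F X))).trace.re ≤ (σ' * (X * star X)).trace.re := by
    rw [hFσ]
    have := hF (star X)
    rw [hstar, star_star, star_star] at this
    exact trace_mul_re_mono hσ this
  have h2 : (ρ * (star (F X) * F X)).trace.re ≤ (ρ' * (star X * X)).trace.re := by
    rw [hFρ]
    exact trace_mul_re_mono hρ (hF X)
  rw [resolventForm, resolventForm, hFρ X]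
  nlinarith

end Matrix

/-! ### The Schwarz inequality for completely positive maps -/

section Schwarz

variable {A B : Type*} [CStarAlgebra A] [PartialOrder A] [StarOrderedRing A]
  [CStarAlgebra B] [PartialOrder B] [StarOrderedRing B]

theorem cp_map_star (E : A →CP B) (x : A) : E (star x) = star (E x) := map_star E x

theorem cstarMatrix_diag_nonneg {n : Type*} [Fintype n] [DecidableEq n] {M : CStarMatrix n n B}
    (hM : 0 ≤ M) (i : n) : 0 ≤ M i i := by
  rw [StarOrderedRing.nonneg_iff] at hM
  induction hM using AddSubmonoid.closure_induction with
  | mem x hx =>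
    obtain ⟨N, rfl⟩ := hx
    simp only [CStarMatrix.mul_apply]
    exact Finset.sum_nonneg fun j _ => star_mul_self_nonneg (N j i)
  | zero => exact le_rfl
  | add x y _ _ hx hy => exact add_nonneg hx hy

/-- The Kadison–Schwarz inequality: positivity of `E` on the `2 × 2` matrix
`((x⋆x, x⋆), (x, 1))`, tested on the column `(1, -E(x))`. -/
theorem cp_schwarz (E : A →CP B) (hE : E 1 = 1) (x : A) :
    star (E x) * E x ≤ E (star x * x) := by
  let N : CStarMatrix (Fin 2) (Fin 2) A := CStarMatrix.ofMatrix !![x, 1; 0, 0]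
  have h1 : 0 ≤ (star N * N).map E := E.map_cstarMatrix_nonneg _ (star_mul_self_nonneg N)
  let w : CStarMatrix (Fin 2) (Fin 2) B := CStarMatrix.ofMatrix !![1, 0; -E x, 0]
  have h2 := cstarMatrix_diag_nonneg (star_left_conjugate_nonneg h1 w) 0
  rw [← sub_nonneg]
  convert h2 using 1
  simp [CStarMatrix.mul_apply, CStarMatrix.star_apply, CStarMatrix.map_apply, Fin.sum_univ_two,
    N, w, hE, cp_map_star, sub_eq_add_neg]

end Schwarz

/-! ### Logarithms of products of commuting Hermitian matrices -/

section Commuting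

variable {n : Type*} [Fintype n] [DecidableEq n]

theorem cfc_mulVec {A : Matrix n n ℂ} (hA : A.IsHermitian) (f : ℝ → ℝ) {v : n → ℂ} {a : ℝ}
    (h : A.mulVec v = (a : ℂ) • v) : (cfc f A).mulVec v = ((f a : ℝ) : ℂ) • v := by
  set U := (hA.eigenvectorUnitary : Matrix n n ℂ) with hU
  have uU : star U * U = 1 := by simp [hU]
  have uU' : U * star U = 1 := by simp [hU]
  have e1 : A = U * Matrix.diagonal (fun i => ((hA.eigenvalues i : ℝ) : ℂ)) * star U := by
    have := cfc_eq_conj hA id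
    rwa [cfc_id ℝ A hA.isSelfAdjoint] at this
  have key : ∀ i, (hA.eigenvalues i : ℂ) * (star U).mulVec v i = (a : ℂ) * (star U).mulVec v i := by
    intro i
    have h1 := congrFun (congrArg (star U).mulVec h) i
    rw [Matrix.mulVec_mulVec, Matrix.mulVec_smul] at h1
    have h2 : star U * A =
        Matrix.diagonal (fun i => ((hA.eigenvalues i : ℝ) : ℂ)) * star U := by
      refine (congrArg (fun r => star U * r) e1).trans ?_
      rw [Matrix.mul_assoc U, ← Matrix.mul_assoc, uU, one_mul]
    rw [h2, ← Matrix.mulVec_mulVec, Matrix.mulVec_diagonal] at h1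
    exact h1
  have hvec : (Matrix.diagonal (fun i => ((f (hA.eigenvalues i) : ℝ) : ℂ))).mulVec
      ((star U).mulVec v) = ((f a : ℝ) : ℂ) • (star U).mulVec v := by
    funext i
    rw [Matrix.mulVec_diagonal, Pi.smul_apply, smul_eq_mul]
    rcases eq_or_ne ((star U).mulVec v i) 0 with h0 | h0
    · rw [h0, mul_zero, mul_zero]
    · rw [Complex.ofReal_injective (mul_right_cancel₀ h0 (key i))]
  rw [cfc_eq_conj hA, ← Matrix.mulVec_mulVec, ← Matrix.mulVec_mulVec, hvec, Matrix.mulVec_smul,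
    Matrix.mulVec_mulVec, uU', Matrix.one_mulVec]

/-- Commuting Hermitian matrices have a spanning set of joint eigenvectors, so an identity of
matrices may be tested on these. -/
theorem eq_of_joint_eigen {A B : Matrix n n ℂ} (hA : A.IsHermitian) (hB : B.IsHermitian)
    (hAB : Commute A B) {M N : Matrix n n ℂ}
    (h : ∀ (v : n → ℂ) (a b : ℝ), A.mulVec v = (a : ℂ) • v → B.mulVec v = (b : ℂ) • v →
      M.mulVec v = N.mulVec v) : M = N := by
  have hA' := Matrix.isSymmetric_toEuclideanLin_iff.2 hA
  have hB' := Matrix.isSymmetric_toEuclideanLin_iff.2 hB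
  have hcomm : Commute (Matrix.toEuclideanLin A) (Matrix.toEuclideanLin B) := by
    refine LinearMap.ext fun v => ?_
    apply (WithLp.ofLp_injective 2)
    simp only [Module.End.mul_apply, Matrix.ofLp_toLpLin, Matrix.toLin'_apply,
      Matrix.mulVec_mulVec, hAB.eq]
  have htop := LinearMap.IsSymmetric.iSup_iSup_eigenspace_inf_eigenspace_eq_top_of_commute hA' hB'
    hcomm
  have hle : (⊤ : Submodule ℂ (EuclideanSpace ℂ n)) ≤
      LinearMap.ker (Matrix.toEuclideanLin M - Matrix.toEuclideanLin N) := by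
    rw [← htop]
    refine iSup_le fun a => iSup_le fun b => ?_
    rintro v ⟨hva, hvb⟩
    rcases eq_or_ne v 0 with rfl | hv
    · simp
    have ha : ((a.re : ℝ) : ℂ) = a := Complex.conj_eq_iff_re.1 <|
      hA'.conj_eigenvalue_eq_self (Module.End.hasEigenvalue_of_hasEigenvector ⟨hva, hv⟩)
    have hb : ((b.re : ℝ) : ℂ) = b := Complex.conj_eq_iff_re.1 <|
      hB'.conj_eigenvalue_eq_self (Module.End.hasEigenvalue_of_hasEigenvector ⟨hvb, hv⟩)
    have e1 := congrArg WithLp.ofLp (Module.End.mem_eigenspace_iff.1 hva)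
    have e2 := congrArg WithLp.ofLp (Module.End.mem_eigenspace_iff.1 hvb)
    rw [Matrix.ofLp_toLpLin, Matrix.toLin'_apply, WithLp.ofLp_smul] at e1 e2
    have := h v.ofLp a.re b.re (by rw [ha]; exact e1) (by rw [hb]; exact e2)
    rw [LinearMap.mem_ker, LinearMap.sub_apply, sub_eq_zero]
    apply (WithLp.ofLp_injective 2)
    rw [Matrix.ofLp_toLpLin, Matrix.toLin'_apply, Matrix.ofLp_toLpLin, Matrix.toLin'_apply, this]
  refine Matrix.toEuclideanLin.injective (sub_eq_zero.1 ?_)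
  exact LinearMap.ker_eq_top.1 (top_le_iff.1 hle)

/-- The logarithm of a product of commuting Hermitian matrices; the factor `A * B` takes care of the
convention `log 0 = 0`. Signs do not matter, since `Real.log x = log |x|`. -/
theorem mul_cfc_log_mul {A B : Matrix n n ℂ} (hA : A.IsHermitian) (hB : B.IsHermitian)
    (hAB : Commute A B) :
    A * B * cfc Real.log (A * B) = A * B * cfc Real.log A + A * B * cfc Real.log B := by
  have hH : (A * B).IsHermitian := (hA.commute_iff hB).1 hAB
  refine eq_of_joint_eigen hA hB hAB fun v a b ha hb => ?_
  have hv : (A * B).mulVec v = ((a * b : ℝ) : ℂ) • v := by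
    rw [← Matrix.mulVec_mulVec, hb, Matrix.mulVec_smul, ha, smul_smul, mul_comm]
    push_cast; rfl
  rw [Matrix.add_mulVec, ← Matrix.mulVec_mulVec, ← Matrix.mulVec_mulVec (M := A * B),
    ← Matrix.mulVec_mulVec (M := A * B), cfc_mulVec hH _ hv,
    cfc_mulVec hA _ ha, cfc_mulVec hB _ hb]
  simp only [Matrix.mulVec_smul, hv, smul_smul, ← add_smul]
  congr 1
  rcases eq_or_ne a 0 with rfl | ha0
  · simp
  rcases eq_or_ne b 0 with rfl | hb0
  · simp
  rw [Real.log_mul ha0 hb0]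
  push_cast; ring

end Commuting

/-! ### Inclusions and partial traces of local algebras -/

section LocalLemmas

variable {V : Type} [DecidableEq V] {d : ℕ}

theorem restr_glue {X Y : Finset V} (h : X ⊆ Y) (ω : X → Fin d)
    (ζ : (Y \ X : Finset V) → Fin d) : restr h (glue ω ζ) = ω := by
  funext x
  simp [restr, glue, Finset.restrict₂]

theorem restr_sdiff_glue {X Y : Finset V} (ω : X → Fin d)
    (ζ : (Y \ X : Finset V) → Fin d) : restr Finset.sdiff_subset (glue ω ζ) = ζ := by
  funext x
  simp [restr, glue, Finset.restrict₂, (Finset.mem_sdiff.1 x.2).2]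

theorem glue_restr {X Y : Finset V} (h : X ⊆ Y) (ω : Y → Fin d) :
    glue (restr h ω) (restr Finset.sdiff_subset ω) = ω := by
  funext x
  simp [restr, glue, Finset.restrict₂]

/-- A configuration on `Y` is a pair of configurations on `X` and `Y \ X`. -/
def glueEquiv {X Y : Finset V} (h : X ⊆ Y) :
    (X → Fin d) × ((Y \ X : Finset V) → Fin d) ≃ (Y → Fin d) where
  toFun p := glue p.1 p.2
  invFun ω := (restr h ω, restr Finset.sdiff_subset ω)
  left_inv _ := Prod.ext (restr_glue h _ _) (restr_sdiff_glue _ _)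
  right_inv ω := glue_restr h ω

theorem sum_glue {X Y : Finset V} (h : X ⊆ Y) {M : Type*} [AddCommMonoid M]
    (f : (Y → Fin d) → M) :
    ∑ ω, f ω = ∑ ξ : X → Fin d, ∑ ζ : (Y \ X : Finset V) → Fin d, f (glue ξ ζ) := by
  rw [← (glueEquiv h).sum_comp, Fintype.sum_prod_type]
  rfl

theorem extend_apply_glue {X Y : Finset V} (h : X ⊆ Y) (a : LocalAlg d X) (ω : Y → Fin d)
    (ξ : X → Fin d) (ζ : (Y \ X : Finset V) → Fin d) :
    extend h a ω (glue ξ ζ) =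
      a (restr h ω) ξ * (1 : LocalAlg d (Y \ X)) (restr Finset.sdiff_subset ω) ζ := by
  rw [extend, Matrix.of_apply, restr_glue h, restr_sdiff_glue]

theorem extend_glue_apply {X Y : Finset V} (h : X ⊆ Y) (a : LocalAlg d X) (η : Y → Fin d)
    (ξ : X → Fin d) (ζ : (Y \ X : Finset V) → Fin d) :
    extend h a (glue ξ ζ) η =
      a ξ (restr h η) * (1 : LocalAlg d (Y \ X)) ζ (restr Finset.sdiff_subset η) := by
  rw [extend, Matrix.of_apply, restr_glue h, restr_sdiff_glue]

set_option linter.unusedSectionVars false in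
theorem restr_eq_restr_iff {X Y : Finset V} (h : X ⊆ Y) (ω η : Y → Fin d) :
    restr h ω = restr h η ↔ ∀ y : Y, (y : V) ∈ X → ω y = η y := by
  constructor
  · intro H y hy
    exact congrFun H ⟨y, hy⟩
  · intro H
    funext x
    exact H ⟨x, h x.2⟩ x.2

theorem extend_apply {X Y : Finset V} (h : X ⊆ Y) (a : LocalAlg d X) (ω η : Y → Fin d) :
    extend h a ω η = a (restr h ω) (restr h η) *
      if ∀ y : Y, (y : V) ∉ X → ω y = η y then 1 else 0 := by
  rw [extend, Matrix.of_apply, Matrix.one_apply]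
  congr 1
  refine if_congr ?_ rfl rfl
  rw [restr_eq_restr_iff]
  exact forall_congr' fun y => by simp

theorem extend_sdiff_apply {X Y : Finset V} (h : X ⊆ Y) (b : LocalAlg d (Y \ X : Finset V))
    (ω η : Y → Fin d) :
    extend Finset.sdiff_subset b ω η =
      b (restr Finset.sdiff_subset ω) (restr Finset.sdiff_subset η) *
        (1 : LocalAlg d X) (restr h ω) (restr h η) := by
  rw [extend_apply, Matrix.one_apply]
  congr 1
  refine if_congr ?_ rfl rfl
  rw [restr_eq_restr_iff]
  exact forall_congr' fun y => by simp

theorem ite_one_zero_mul_ite_one_zero (p q : Prop) [Decidable p] [Decidable q] :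
    (if p then (1 : ℂ) else 0) * (if q then 1 else 0) = if p ∧ q then 1 else 0 := by
  by_cases p <;> by_cases q <;> simp [*]

theorem extend_one {X Y : Finset V} (h : X ⊆ Y) : extend h (1 : LocalAlg d X) = 1 := by
  ext ω η
  rw [extend, Matrix.of_apply, Matrix.one_apply, Matrix.one_apply, Matrix.one_apply,
    ite_one_zero_mul_ite_one_zero]
  refine if_congr ⟨fun H => ?_, fun H => H ▸ ⟨rfl, rfl⟩⟩ rfl rfl
  rw [← glue_restr h ω, H.1, H.2, glue_restr]

theorem extend_mul {X Y : Finset V} (h : X ⊆ Y) (a b : LocalAlg d X) :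
    extend h (a * b) = extend h a * extend h b := by
  ext ω η
  rw [Matrix.mul_apply, sum_glue h]
  simp only [extend_apply_glue, extend_glue_apply]
  rw [extend, Matrix.of_apply, Matrix.mul_apply, Finset.sum_mul]
  refine Finset.sum_congr rfl fun ξ _ => ?_
  simp only [Matrix.one_apply, mul_ite, mul_one, mul_zero, ite_mul, zero_mul]
  simp

/-- The inclusion `𝒜_X ⊆ 𝒜_Y` is a homomorphism of star algebras. -/
def extendHom {X Y : Finset V} (h : X ⊆ Y) : LocalAlg d X →⋆ₐ[ℂ] LocalAlg d Y where
  toFun := extend h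
  map_one' := extend_one h
  map_mul' := extend_mul h
  map_zero' := by ext ω η; simp [extend]
  map_add' a b := by ext ω η; simp [extend, add_mul]
  commutes' c := by
    rw [Algebra.algebraMap_eq_smul_one, Algebra.algebraMap_eq_smul_one, ← extend_one h]
    ext ω η
    simp [extend, mul_assoc]
  map_star' a := by
    ext ω η
    simp only [extend, Matrix.star_apply, Matrix.of_apply, star_mul', Matrix.one_apply, eq_comm,
      apply_ite star, star_one, star_zero]

theorem extendHom_apply {X Y : Finset V} (h : X ⊆ Y) (a : LocalAlg d X) :
    extendHom h a = extend h a := rfl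

theorem extend_extend {X Y Z : Finset V} (h : X ⊆ Y) (h' : Y ⊆ Z) (a : LocalAlg d X) :
    extend h' (extend h a) = extend (h.trans h') a := by
  ext ω η
  rw [extend_apply, extend_apply, extend_apply, mul_assoc, ite_one_zero_mul_ite_one_zero]
  congr 1
  refine if_congr ⟨fun H z hz => ?_, fun H => ⟨fun y hy => H ⟨y, h' y.2⟩ hy, fun z hz =>
    H z fun hx => hz (h hx)⟩⟩ rfl rfl
  by_cases hy : (z : V) ∈ Y
  · exact H.1 ⟨z, hy⟩ hz
  · exact H.2 z hy

theorem trace_extend_mul {X Y : Finset V} (h : X ⊆ Y) (a : LocalAlg d X) (b : LocalAlg d Y) :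
    (extend h a * b).trace = (a * partialTrace X Y b).trace := by
  simp only [Matrix.trace, Matrix.diag_apply, Matrix.mul_apply]
  rw [sum_glue h]
  refine Finset.sum_congr rfl fun ξ _ => ?_
  simp only [sum_glue h, extend_apply_glue, restr_glue, partialTrace,
    Matrix.of_apply, Finset.mul_sum]
  rw [Finset.sum_comm]
  refine Finset.sum_congr rfl fun η _ => Finset.sum_congr rfl fun ζ _ => ?_
  simp [Matrix.one_apply, restr_sdiff_glue]

theorem extend_mul_extend_sdiff_apply {X Y : Finset V} (h : X ⊆ Y) (a : LocalAlg d X)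
    (b : LocalAlg d (Y \ X : Finset V)) (ω η : Y → Fin d) :
    (extend h a * extend Finset.sdiff_subset b) ω η =
      a (restr h ω) (restr h η) *
        b (restr Finset.sdiff_subset ω) (restr Finset.sdiff_subset η) := by
  rw [Matrix.mul_apply, sum_glue h]
  simp only [extend_apply_glue, extend_sdiff_apply h, restr_glue, restr_sdiff_glue,
    Matrix.one_apply, mul_ite, mul_one, mul_zero, ite_mul, zero_mul]
  simp

/-- In a product over disjoint regions the entries multiply. -/
theorem extend_mul_extend_apply {X Z Y : Finset V} (hX : X ⊆ Y) (hZ : Z ⊆ Y) (hXZ : Y \ X = Z)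
    (a : LocalAlg d X) (b : LocalAlg d Z) (ω η : Y → Fin d) :
    (extend hX a * extend hZ b) ω η =
      a (restr hX ω) (restr hX η) * b (restr hZ ω) (restr hZ η) := by
  subst hXZ
  exact extend_mul_extend_sdiff_apply hX a b ω η

/-- Averaging over the matrix units of `𝒜_X` traces out the region `X`. -/
theorem sum_single_mul_mul_single {X Z Y : Finset V} (hX : X ⊆ Y) (hZ : Z ⊆ Y) (hXZ : Y \ Z = X)
    (x : LocalAlg d Y) :
    ∑ i : X → Fin d, ∑ j : X → Fin d, extend hX (Matrix.single i j 1) * x *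
      extend hX (Matrix.single j i 1) = extend hZ (partialTrace Z Y x) := by
  subst hXZ
  have hl (i j : (Y \ Z : Finset V) → Fin d) (y : LocalAlg d Y) (ω η : Y → Fin d) :
      (extend Finset.sdiff_subset (Matrix.single i j 1) * y) ω η =
        if i = restr Finset.sdiff_subset ω then y (glue (restr hZ ω) j) η else 0 := by
    rw [Matrix.mul_apply, sum_glue hZ]
    simp only [extend_sdiff_apply hZ, restr_glue, restr_sdiff_glue, Matrix.single_apply,
      Matrix.one_apply, ite_mul, one_mul, zero_mul]
    by_cases hi : i = restr Finset.sdiff_subset ω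
    · simp [hi]
    · simp [hi]
  have hr (i j : (Y \ Z : Finset V) → Fin d) (y : LocalAlg d Y) (ω η : Y → Fin d) :
      (y * extend Finset.sdiff_subset (Matrix.single j i 1)) ω η =
        if i = restr Finset.sdiff_subset η then y ω (glue (restr hZ η) j) else 0 := by
    rw [Matrix.mul_apply, sum_glue hZ]
    simp only [extend_sdiff_apply hZ, restr_glue, restr_sdiff_glue, Matrix.single_apply,
      Matrix.one_apply, mul_ite, mul_one, mul_zero]
    by_cases hi : i = restr Finset.sdiff_subset η
    · simp [hi]
    · simp [hi]
  ext ω η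
  simp only [Matrix.sum_apply, hr, hl]
  rw [extend, Matrix.of_apply, partialTrace, Matrix.of_apply, Matrix.one_apply]
  by_cases h : restr (Y := Y) (Finset.sdiff_subset (t := Z)) ω = restr Finset.sdiff_subset η
  · rw [if_pos h, mul_one, Finset.sum_eq_single (restr Finset.sdiff_subset η)]
    · simp [h]
    · intro i _ hi
      simp [hi]
    · intro H; exact absurd (Finset.mem_univ _) H
  · rw [if_neg h, mul_zero]
    refine Finset.sum_eq_zero fun i _ => Finset.sum_eq_zero fun j _ => ?_
    by_cases hi : i = restr Finset.sdiff_subset η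
    · rw [if_pos hi, if_neg fun h' => h (h'.symm.trans hi)]
    · rw [if_neg hi]

theorem localEmb_extend {X Y : Finset V} (h : X ⊆ Y) (a : LocalAlg d X) :
    localEmb Y (extend h a) = localEmb X a := by
  refine Subtype.ext ?_
  change actCLM (extend h a) = actCLM a
  ext f ω
  rw [actCLM_apply, actCLM_apply, sum_glue h]
  refine Finset.sum_congr rfl fun ξ _ => ?_
  simp only [extend_apply_glue]
  rw [Finset.sum_eq_single (restr Finset.sdiff_subset (Y.restrict ω))]
  · rw [Matrix.one_apply_eq, mul_one]
    refine congrArg (fun θ => a _ ξ * f θ) ?_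
    funext v
    by_cases hX : v ∈ X
    · simp [Function.updateFinset, hX, h hX, glue]
    · by_cases hY : v ∈ Y <;> simp [Function.updateFinset, hX, hY, glue, restr, Finset.restrict₂]
  · intro ζ _ hζ
    rw [Matrix.one_apply_ne hζ.symm, mul_zero, zero_mul]
  · intro H; exact absurd (Finset.mem_univ _) H

theorem cfc_extend {X Y : Finset V} (h : X ⊆ Y) (f : ℝ → ℝ) {a : LocalAlg d X}
    (ha : a.IsHermitian) : cfc f (extend h a) = extend h (cfc f a) := by
  refine ((extendHom (d := d) h).map_cfc (S := ℂ) f a (a.finite_real_spectrum.continuousOn _) ?_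
    ha.isSelfAdjoint
    (ha.isSelfAdjoint.map (extendHom h))).symm
  exact LinearMap.continuous_of_finiteDimensional (extendHom (d := d) h).toAlgHom.toLinearMap

end LocalLemmas

/-! ### Density matrices -/

section Density

variable {V : Type} [DecidableEq V] {d : ℕ}

/-- Positivity of the functional `Tr(M ·)` on the rank one matrices `v v⋆` gives `M ≥ 0`. -/
theorem posSemidef_of_trace_nonneg {n : Type*} [Fintype n] [DecidableEq n] {M : Matrix n n ℂ}
    (h : ∀ a : Matrix n n ℂ, 0 ≤ (M * (star a * a)).trace) : M.PosSemidef := by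
  have key (v : n → ℂ) : 0 ≤ star v ⬝ᵥ (M.mulVec v) := by
    rcases isEmpty_or_nonempty n with hn | ⟨⟨i₀⟩⟩
    · simp [dotProduct]
    have h1 := h (Matrix.vecMulVec (Pi.single i₀ 1) (star v))
    have h2 : star (Matrix.vecMulVec (Pi.single i₀ (1 : ℂ)) (star v)) *
        Matrix.vecMulVec (Pi.single i₀ 1) (star v) = Matrix.vecMulVec v (star v) := by
      rw [Matrix.star_eq_conjTranspose, Matrix.conjTranspose_vecMulVec, star_star,
        Matrix.vecMulVec_mul_vecMulVec, ← Pi.single_star]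
      simp
    rwa [h2, Matrix.mul_vecMulVec, Matrix.trace_vecMulVec, dotProduct_comm] at h1
  rw [← Matrix.isPositive_toEuclideanLin_iff, LinearMap.isPositive_iff_complex]
  intro v
  have h0 := key v.ofLp
  have h1 : inner ℂ (Matrix.toEuclideanLin M v) v = star v.ofLp ⬝ᵥ (M.mulVec v.ofLp) := by
    rw [EuclideanSpace.inner_eq_star_dotProduct, Matrix.ofLp_toLpLin, Matrix.toLin'_apply,
      ← (IsSelfAdjoint.of_nonneg h0).star_eq, dotProduct_comm, Matrix.star_dotProduct]
  rw [h1]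
  have := RCLike.nonneg_iff.1 h0
  exact ⟨Complex.ext rfl this.2.symm, this.1⟩

theorem density_posSemidef {φ : QuasiLocal V d →ₗ[ℂ] ℂ} (hφ : IsState φ) (Λ : Finset V) :
    (density φ Λ).PosSemidef :=
  posSemidef_of_trace_nonneg fun a => by
    rw [trace_density_mul, map_mul, map_star]
    exact hφ.nonneg _

theorem eq_density {φ : QuasiLocal V d →ₗ[ℂ] ℂ} {Λ : Finset V} {M : LocalAlg d Λ}
    (h : ∀ ω η, (M * Matrix.single ω η 1).trace = φ (localEmb Λ (Matrix.single ω η 1))) :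
    M = density φ Λ := by
  ext ω η
  have := h η ω
  rw [Matrix.trace_mul_single] at this
  simpa [density] using this

end Density

/-! ### Conditional entropies of quantum Markov states -/

section Entropy

variable {V : Type} [DecidableEq V] {d : ℕ}

theorem entropy_eq (φ : QuasiLocal V d →ₗ[ℂ] ℂ) (Λ : Finset V) :
    entropy φ Λ = -(density φ Λ * cfc Real.log (density φ Λ)).trace.re := rfl

/-- The functional `Tr_X ⊗ φ|_{𝒜_Z}` on `𝒜_Y`, where `Y` is the disjoint union of `X` and `Z`, is
obtained from `φ` by averaging over the matrix units of `𝒜_X`. -/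
theorem trace_extend_density_mul (φ : QuasiLocal V d →ₗ[ℂ] ℂ) {X Z Y : Finset V} (hX : X ⊆ Y)
    (hZ : Z ⊆ Y) (hXZ : Y \ Z = X) (x : LocalAlg d Y) :
    (extend hZ (density φ Z) * x).trace = ∑ i : X → Fin d, ∑ j : X → Fin d,
      φ (localEmb Y (extend hX (Matrix.single i j 1) * x * extend hX (Matrix.single j i 1))) := by
  rw [trace_extend_mul, trace_density_mul, ← localEmb_extend hZ,
    ← sum_single_mul_mul_single hX hZ hXZ]
  simp only [map_sum]

theorem trace_density_mul_log_extend (φ : QuasiLocal V d →ₗ[ℂ] ℂ) (hφ : IsState φ) {Z Y : Finset V}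
    (hZ : Z ⊆ Y) :
    (density φ Y * cfc Real.log (extend hZ (density φ Z))).trace.re = -entropy φ Z := by
  rw [cfc_extend hZ _ (density_posSemidef hφ Z).isHermitian, trace_density_mul, localEmb_extend,
    ← trace_density_mul, entropy_eq, neg_neg]

theorem extend_posSemidef {X Y : Finset V} (h : X ⊆ Y) {a : LocalAlg d X} (ha : a.PosSemidef) :
    (extend h a).PosSemidef := by
  rw [← Matrix.nonneg_iff_posSemidef] at ha ⊢
  exact map_nonneg (extendHom h) ha

/-- The kernel of `1 ⊗ D_Z` is contained in that of `D_Y`. -/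
theorem density_mulVec_eq_zero {φ : QuasiLocal V d →ₗ[ℂ] ℂ} (hφ : IsState φ) {Z Y : Finset V}
    (hZ : Z ⊆ Y) {v : (Y → Fin d) → ℂ} (hv : (extend hZ (density φ Z)).mulVec v = 0) :
    (density φ Y).mulVec v = 0 := by
  have hρ := density_posSemidef hφ Y
  have h0 := trace_extend_density_mul φ Finset.sdiff_subset hZ rfl (Matrix.vecMulVec v (star v))
  rw [Matrix.mul_vecMulVec, hv, Matrix.zero_vecMulVec, Matrix.trace_zero] at h0
  -- Each term of the average is a value of the quadratic form of `D_Y`, hence nonnegative; as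
  -- they sum to zero, `D_Y` annihilates every `e_ij v`, and `v = ∑ e_ii v`.
  have hterm (i j : (Y \ Z : Finset V) → Fin d) :
      φ (localEmb Y (extend Finset.sdiff_subset (Matrix.single i j 1) *
        Matrix.vecMulVec v (star v) * extend Finset.sdiff_subset (Matrix.single j i 1))) =
      star ((extend Finset.sdiff_subset (Matrix.single i j (1 : ℂ))).mulVec v) ⬝ᵥ
        (density φ Y).mulVec ((extend Finset.sdiff_subset (Matrix.single i j 1)).mulVec v) := by
    have h1 : extend Finset.sdiff_subset (Matrix.single j i (1 : ℂ)) =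
        star (extend (Y := Y) Finset.sdiff_subset (Matrix.single i j (1 : ℂ))) := by
      rw [← extendHom_apply, ← extendHom_apply, ← map_star, Matrix.star_eq_conjTranspose,
        Matrix.conjTranspose_single, star_one]
    rw [h1, ← trace_density_mul, Matrix.mul_vecMulVec, Matrix.vecMulVec_mul, Matrix.mul_vecMulVec,
      Matrix.trace_vecMulVec, dotProduct_comm, Matrix.star_mulVec, Matrix.star_eq_conjTranspose]
  have hpos (i j : (Y \ Z : Finset V) → Fin d) := hρ.dotProduct_mulVec_nonneg
    ((extend Finset.sdiff_subset (Matrix.single i j (1 : ℂ))).mulVec v)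
  simp only [hterm] at h0
  have hzero (i : (Y \ Z : Finset V) → Fin d) :
      (density φ Y).mulVec
        ((extend Finset.sdiff_subset (Matrix.single i i (1 : ℂ))).mulVec v) = 0 := by
    rw [← hρ.dotProduct_mulVec_zero_iff]
    have h1 := (Finset.sum_eq_zero_iff_of_nonneg
      fun i _ => Finset.sum_nonneg fun j _ => hpos i j).1 h0.symm i (Finset.mem_univ i)
    exact (Finset.sum_eq_zero_iff_of_nonneg fun j _ => hpos i j).1 h1 i (Finset.mem_univ i)
  have hone : (1 : LocalAlg d Y) = ∑ i : (Y \ Z : Finset V) → Fin d,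
      extend Finset.sdiff_subset (Matrix.single i i (1 : ℂ)) := by
    simp only [← extendHom_apply]
    rw [← map_sum, ← map_one (extendHom (d := d) (Finset.sdiff_subset (s := Y) (t := Z))),
      ← Matrix.diagonal_one, ← Matrix.sum_single_eq_diagonal]
  rw [← Matrix.one_mulVec v, hone, Matrix.sum_mulVec, Matrix.mulVec_sum]
  exact Finset.sum_eq_zero fun i _ => hzero i

/-- Monotonicity of the relative entropy of `D_Y` and `1 ⊗ D_Z`, as an inequality between
conditional entropies. The hypothesis `hbi` says that `F` is a bimodule map over `𝒜_X`, so that it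
also intertwines the functionals `Tr_X ⊗ φ|_{𝒜_Z}` and `Tr_X ⊗ φ|_{𝒜_Z'}`. -/
theorem entropy_sub_entropy_le {φ : QuasiLocal V d →ₗ[ℂ] ℂ} (hφ : IsState φ)
    {X Z Y Z' Y' : Finset V} (hX : X ⊆ Y) (hZ : Z ⊆ Y) (hXZ : Y \ Z = X)
    (hX' : X ⊆ Y') (hZ' : Z' ⊆ Y') (hXZ' : Y' \ Z' = X)
    (F : LocalAlg d Y' → LocalAlg d Y) (hone : F 1 = 1) (hstar : ∀ x, F (star x) = star (F x))
    (hF : ∀ x, star (F x) * F x ≤ F (star x * x))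
    (hbi : ∀ (c c' : LocalAlg d X) x,
      F (extend hX' c * x * extend hX' c') = extend hX c * F x * extend hX c')
    (hinv : ∀ x, φ (localEmb Y (F x)) = φ (localEmb Y' x)) :
    entropy φ Y - entropy φ Z ≤ entropy φ Y' - entropy φ Z' := by
  have h := relativeEntropy_mono (density_posSemidef hφ Y)
    (extend_posSemidef hZ (density_posSemidef hφ Z)) (density_posSemidef hφ Y')
    (extend_posSemidef hZ' (density_posSemidef hφ Z')) (fun v => density_mulVec_eq_zero hφ hZ)
    (fun v => density_mulVec_eq_zero hφ hZ') F hone hstar hF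
    (fun x => by rw [trace_density_mul, trace_density_mul, hinv])
    (fun x => by
      rw [trace_extend_density_mul φ hX hZ hXZ, trace_extend_density_mul φ hX' hZ' hXZ']
      simp only [← hbi, hinv])
  rw [trace_density_mul_log_extend φ hφ, trace_density_mul_log_extend φ hφ] at h
  rw [entropy_eq φ Y, entropy_eq φ Y']
  linarith

end Entropy

section Markov

variable {k d : ℕ}

theorem ball_sdiff_level (k n : ℕ) : ball k n \ level k n = below k n := by
  ext x
  rw [Finset.mem_sdiff, mem_ball, mem_level, mem_below]
  omega

theorem ball_sdiff_shell (k n : ℕ) : ball k (n + 1) \ shell k n = below k n := by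
  ext x
  rw [Finset.mem_sdiff, mem_ball, mem_shell, mem_below]
  omega

/-- A quasi-conditional expectation is a bimodule map: multiplicativity on the right follows by
taking adjoints. -/
theorem IsQuasiCondExp.map_mul_mul {V : Type} [DecidableEq V] {X Y Z : Finset V} {hXY : X ⊆ Y}
    {hYZ : Y ⊆ Z} {E : LocalAlg d Z →CP LocalAlg d Y} (hE : IsQuasiCondExp hXY hYZ E)
    (c c' : LocalAlg d X) (x : LocalAlg d Z) :
    E (extend (hXY.trans hYZ) c * x * extend (hXY.trans hYZ) c') =
      extend hXY c * E x * extend hXY c' := by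
  have hright (y : LocalAlg d Z) :
      E (y * extend (hXY.trans hYZ) c') = E y * extend hXY c' := by
    have h := congrArg star (hE.map_mul (star c') (star y))
    rwa [← cp_map_star, star_mul, star_mul, ← cp_map_star, star_star, ← extendHom_apply,
      ← extendHom_apply, ← map_star, ← map_star, star_star] at h
  rw [hright, hE.map_mul]

/-- The two inequalities come from monotonicity under `E` and under the inclusion
`𝒜_{Λ_n} ⊆ 𝒜_{Λ_{n+1}}`. -/
theorem entropy_add_entropy {φ : QuasiLocal (Vertex k) d →ₗ[ℂ] ℂ} (hφ : IsState φ) {n : ℕ}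
    {E : LocalAlg d (ball k (n + 1)) →CP LocalAlg d (ball k n)}
    (hE : IsQuasiCondExp (below_subset_ball k n) (ball_subset_succ k n) E)
    (hinv : ∀ a, φ (localEmb (ball k n) (E a)) = φ (localEmb (ball k (n + 1)) a)) :
    entropy φ (ball k (n + 1)) + entropy φ (level k n) =
      entropy φ (ball k n) + entropy φ (shell k n) := by
  have h1 := entropy_sub_entropy_le hφ (below_subset_ball k n) (level_subset_ball k n)
    (ball_sdiff_level k n) (below_subset_ball_succ k n) (shell_subset_ball k n)
    (ball_sdiff_shell k n) E hE.transition (cp_map_star E) (cp_schwarz E hE.transition)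
    hE.map_mul_mul hinv
  have h2 := entropy_sub_entropy_le hφ (below_subset_ball_succ k n) (shell_subset_ball k n)
    (ball_sdiff_shell k n) (below_subset_ball k n) (level_subset_ball k n)
    (ball_sdiff_level k n) (extendHom (ball_subset_succ k n)) (map_one _) (map_star _)
    (fun x => by rw [map_mul, map_star])
    (fun c c' x => by simp only [map_mul, extendHom_apply, extend_extend])
    (fun x => congrArg φ (localEmb_extend _ x))
  linarith

end Markov

/-! ### Tensor products over a partition -/

section Tensor

variable {V : Type} [DecidableEq V] {d : ℕ}

/-- `Y` is the disjoint union of the sets `B x`, `x ∈ I`. -/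
structure IsPartition (I : Finset V) (B : V → Finset V) (Y : Finset V) : Prop where
  subset : ∀ x ∈ I, B x ⊆ Y
  cover : ∀ y ∈ Y, ∃ x ∈ I, y ∈ B x
  unique : ∀ x ∈ I, ∀ x' ∈ I, ∀ y, y ∈ B x → y ∈ B x' → x = x'

variable {I : Finset V} {B : V → Finset V} {Y : Finset V}

set_option linter.unusedSectionVars false in
theorem IsPartition.eq_of_restr_eq (hP : IsPartition I B Y) {ω η : Y → Fin d}
    (H : ∀ x : I, restr (hP.subset x x.2) ω = restr (hP.subset x x.2) η) : ω = η := by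
  funext y
  obtain ⟨x, hx, hy⟩ := hP.cover y y.2
  exact congrFun (H ⟨x, hx⟩) ⟨y, hy⟩

theorem IsPartition.restr_bijective (hP : IsPartition I B Y) :
    Function.Bijective fun (ω : Y → Fin d) (x : I) => restr (hP.subset x x.2) ω := by
  refine ⟨fun ω η H => hP.eq_of_restr_eq fun x => congrFun H x, fun g => ?_⟩
  choose f hfI hfB using hP.cover
  refine ⟨fun y => g ⟨f y y.2, hfI y y.2⟩ ⟨y, hfB y y.2⟩, ?_⟩
  funext x y
  have hy := hP.subset x x.2 y.2
  have key : ∀ (x' : I) (h : (y : V) ∈ B x'), x' = x → g x' ⟨y, h⟩ = g x y := by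
    rintro x' h rfl
    rfl
  exact key ⟨f y hy, hfI y hy⟩ (hfB y hy)
    (Subtype.ext (hP.unique _ (hfI y hy) x x.2 y (hfB y hy) y.2))

/-- Distributivity: the configurations on `Y` are the families of configurations on the parts. -/
theorem IsPartition.sum_prod_restr (hP : IsPartition I B Y)
    (f : ∀ x : I, ((B x) → Fin d) → ℂ) :
    ∑ ω : Y → Fin d, ∏ x : I, f x (restr (hP.subset x x.2) ω) = ∏ x : I, ∑ ζ, f x ζ := by
  rw [Finset.prod_univ_sum, Fintype.piFinset_univ]
  exact Fintype.sum_bijective _ hP.restr_bijective _ _ fun ω => rfl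

set_option linter.unusedSectionVars false in
theorem tensor_congr (h : ∀ x ∈ I, B x ⊆ Y) {a b : ∀ x, LocalAlg d (B x)}
    (hab : ∀ x ∈ I, a x = b x) : tensor h a = tensor h b := by
  ext ω η
  simp only [tensor, Matrix.of_apply]
  exact Finset.prod_congr rfl fun x _ => by rw [hab x x.2]

theorem IsPartition.tensor_mul (hP : IsPartition I B Y) (a b : ∀ x, LocalAlg d (B x)) :
    tensor hP.subset (fun x => a x * b x) = tensor hP.subset a * tensor hP.subset b := by
  ext ω η
  simp only [tensor, Matrix.of_apply, Matrix.mul_apply, ← Finset.prod_mul_distrib]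
  exact (hP.sum_prod_restr fun x ζ => a x (restr (hP.subset x x.2) ω) ζ *
    b x ζ (restr (hP.subset x x.2) η)).symm

set_option linter.unusedSectionVars false in
theorem tensor_star (h : ∀ x ∈ I, B x ⊆ Y) (a : ∀ x, LocalAlg d (B x)) :
    tensor h (fun x => star (a x)) = star (tensor h a) := by
  ext ω η
  simp only [tensor, Matrix.of_apply, Matrix.star_apply, star_prod]

/-- The tensor product of `a` at the site `x` and `1` at the other sites. -/
theorem IsPartition.tensor_update_one (hP : IsPartition I B Y) {x : V} (hx : x ∈ I)
    (a : LocalAlg d (B x)) :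
    tensor hP.subset (Function.update (fun y => (1 : LocalAlg d (B y))) x a) =
      extend (hP.subset x hx) a := by
  ext ω η
  rw [extend_apply, tensor, Matrix.of_apply]
  by_cases h : ∀ y : Y, (y : V) ∉ B x → ω y = η y
  · rw [if_pos h, mul_one, Finset.prod_eq_single (⟨x, hx⟩ : I)]
    · simp
    · intro z _ hz
      have hzx : (z : V) ≠ x := fun H => hz (Subtype.ext H)
      rw [Function.update_of_ne hzx, Matrix.one_apply, if_pos]
      rw [restr_eq_restr_iff]
      exact fun y hy => h y fun hy' => hzx (hP.unique z z.2 x hx y hy hy')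
    · intro H; exact absurd (Finset.mem_univ _) H
  · rw [if_neg h, mul_zero]
    push Not at h
    obtain ⟨y, hyx, hy⟩ := h
    obtain ⟨z, hz, hyz⟩ := hP.cover y y.2
    have hzx : z ≠ x := by rintro rfl; exact hyx hyz
    refine Finset.prod_eq_zero (Finset.mem_univ (⟨z, hz⟩ : I)) ?_
    rw [Function.update_of_ne hzx, Matrix.one_apply, if_neg]
    rw [restr_eq_restr_iff]
    exact fun H => hy (H y hyz)

theorem IsPartition.tensor_one (hP : IsPartition I B Y) :
    tensor hP.subset (fun x => (1 : LocalAlg d (B x))) = 1 := by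
  ext ω η
  rw [tensor, Matrix.of_apply]
  by_cases h : ω = η
  · subst h
    simp
  · rw [Matrix.one_apply_ne h]
    by_contra H
    refine h (hP.eq_of_restr_eq fun x => ?_)
    by_contra hx
    exact H (Finset.prod_eq_zero (Finset.mem_univ x) (Matrix.one_apply_ne hx))

theorem IsPartition.extend_mul_tensor (hP : IsPartition I B Y) {x : V} (hx : x ∈ I)
    (a : ∀ x, LocalAlg d (B x)) :
    extend (hP.subset x hx) (a x) * tensor hP.subset (Function.update a x 1) =
      tensor hP.subset a := by
  rw [← hP.tensor_update_one hx, ← hP.tensor_mul]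
  refine tensor_congr _ fun y _ => ?_
  rcases eq_or_ne y x with rfl | hy
  · simp
  · simp [Function.update_of_ne hy]

theorem IsPartition.tensor_mul_extend (hP : IsPartition I B Y) {x : V} (hx : x ∈ I)
    (a : ∀ x, LocalAlg d (B x)) :
    tensor hP.subset (Function.update a x 1) * extend (hP.subset x hx) (a x) =
      tensor hP.subset a := by
  rw [← hP.tensor_update_one hx, ← hP.tensor_mul]
  refine tensor_congr _ fun y _ => ?_
  rcases eq_or_ne y x with rfl | hy
  · simp
  · simp [Function.update_of_ne hy]

theorem tensor_isHermitian (h : ∀ x ∈ I, B x ⊆ Y) {a : ∀ x, LocalAlg d (B x)}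
    (ha : ∀ x, (a x).IsHermitian) : (tensor h a).IsHermitian := by
  change star (tensor h a) = tensor h a
  rw [← tensor_star]
  exact tensor_congr h fun x _ => ha x

/-- Induction on a set `J` of sites outside of which `a` is `1`. The sum can run over all sites,
since `log 1 = 0`. -/
theorem IsPartition.tensor_mul_cfc_log_aux (hP : IsPartition I B Y) (J : Finset V) :
    J ⊆ I → ∀ a : ∀ x, LocalAlg d (B x), (∀ x, (a x).IsHermitian) → (∀ x ∉ J, a x = 1) →
    tensor hP.subset a * cfc Real.log (tensor hP.subset a) =
      tensor hP.subset a * ∑ x : I, extend (hP.subset x x.2) (cfc Real.log (a x)) := by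
  induction J using Finset.induction_on with
  | empty =>
    intro _ a _ h1
    have hz : ∑ x : I, extend (hP.subset x x.2) (cfc Real.log (a x)) = 0 := by
      refine Finset.sum_eq_zero fun x _ => ?_
      rw [h1 x (Finset.notMem_empty _), cfc_apply_one, Real.log_one, map_zero]
      exact map_zero (extendHom (hP.subset x x.2))
    rw [hz, tensor_congr hP.subset (b := fun x => 1) fun x _ => h1 x (Finset.notMem_empty _),
      hP.tensor_one, cfc_apply_one]
    simp
  | insert x J hxJ ih =>
    intro hJ a ha h1
    have hx : x ∈ I := hJ (Finset.mem_insert_self x J)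
    have hupd : ∀ y, (Function.update a x 1 y).IsHermitian := fun y => by
      rcases eq_or_ne y x with rfl | hy
      · simp [Matrix.isHermitian_one]
      · simpa [Function.update_of_ne hy] using ha y
    have h := ih ((Finset.subset_insert x J).trans hJ) (Function.update a x 1) hupd fun y hy => by
      rcases eq_or_ne y x with rfl | hyx
      · simp
      · simpa [Function.update_of_ne hyx] using h1 y (by simp [hyx, hy])
    have hsum : ∑ y : I, extend (hP.subset y y.2) (cfc Real.log (a y)) =
        extend (hP.subset x hx) (cfc Real.log (a x)) +
          ∑ y : I, extend (hP.subset y y.2) (cfc Real.log (Function.update a x 1 y)) := by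
      rw [← Finset.add_sum_erase Finset.univ _ (Finset.mem_univ (⟨x, hx⟩ : I)),
        ← Finset.add_sum_erase Finset.univ (fun y : I =>
          extend (hP.subset y y.2) (cfc Real.log (Function.update a x 1 y)))
          (Finset.mem_univ (⟨x, hx⟩ : I))]
      have h0 : extend (hP.subset x hx) (cfc Real.log (Function.update a x 1 x)) = 0 := by
        rw [Function.update_self, cfc_apply_one, Real.log_one, map_zero]
        exact map_zero (extendHom (d := d) (hP.subset x hx))
      rw [h0, zero_add]
      congr 1
      refine Finset.sum_congr rfl fun y hy => ?_
      rw [Function.update_of_ne fun H => Finset.ne_of_mem_erase hy (Subtype.ext H)]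
    have hA : (extend (hP.subset x hx) (a x)).IsHermitian := by
      change star (extendHom (hP.subset x hx) (a x)) = _
      rw [← map_star, Matrix.star_eq_conjTranspose, ha x, extendHom_apply]
    have hcomm : Commute (extend (hP.subset x hx) (a x))
        (tensor hP.subset (Function.update a x 1)) :=
      (hP.extend_mul_tensor hx a).trans (hP.tensor_mul_extend hx a).symm
    have h2 := mul_cfc_log_mul hA (tensor_isHermitian hP.subset hupd) hcomm
    rw [Matrix.mul_assoc _ _ (cfc Real.log (tensor _ _)), h, ← Matrix.mul_assoc,
      hP.extend_mul_tensor hx] at h2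
    rw [h2, hsum, mul_add, cfc_extend _ _ (ha x)]

/-- The logarithm of a tensor product is the sum of the logarithms, up to the convention
`log 0 = 0`. -/
theorem IsPartition.tensor_mul_cfc_log (hP : IsPartition I B Y) {a : ∀ x, LocalAlg d (B x)}
    (ha : ∀ x, (a x).IsHermitian) :
    tensor hP.subset a * cfc Real.log (tensor hP.subset a) =
      tensor hP.subset a * ∑ x : I, extend (hP.subset x x.2) (cfc Real.log (a x)) := by
  classical
  let b : ∀ x, LocalAlg d (B x) := fun x => if x ∈ I then a x else 1
  have hb : ∀ x ∈ I, b x = a x := fun x hx => by simp [b, hx]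
  have h := hP.tensor_mul_cfc_log_aux I subset_rfl b
    (fun x => by by_cases hx : x ∈ I <;> simp [b, hx, ha x, Matrix.isHermitian_one])
    (fun x hx => by simp [b, hx])
  rw [tensor_congr hP.subset hb] at h
  rw [h]
  congr 1
  exact Finset.sum_congr rfl fun x _ => by rw [hb x x.2]

theorem IsPartition.tensor_single (hP : IsPartition I B Y) (ω η : Y → Fin d) :
    tensor hP.subset (fun x => if hx : x ∈ I then Matrix.single (restr (hP.subset x hx) ω)
      (restr (hP.subset x hx) η) (1 : ℂ) else 1) = Matrix.single ω η 1 := by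
  ext α β
  rw [tensor, Matrix.of_apply, Matrix.single_apply]
  split_ifs with h
  · obtain ⟨rfl, rfl⟩ := h
    exact Finset.prod_eq_one fun x _ => by simp
  · by_contra H
    have H' : ∀ x : I, restr (hP.subset x x.2) ω = restr (hP.subset x x.2) α ∧
        restr (hP.subset x x.2) η = restr (hP.subset x x.2) β := by
      intro x
      by_contra hx
      refine H (Finset.prod_eq_zero (Finset.mem_univ x) ?_)
      rw [dif_pos x.2, Matrix.single_apply, if_neg hx]
    exact h ⟨hP.eq_of_restr_eq fun x => (H' x).1, hP.eq_of_restr_eq fun x => (H' x).2⟩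

/-- `log (K K⋆) = 2 log |K|`. -/
theorem cfc_log_mul_star {Λ : Finset V} (K : LocalAlg d Λ) :
    cfc Real.log (K * star K) = (2 : ℂ) • cfc Real.log (modulus K) := by
  have hsa : IsSelfAdjoint (K * star K) := IsSelfAdjoint.mul_star_self K
  have hfin := (K * star K).finite_real_spectrum
  rw [modulus, ← cfc_comp Real.log Real.sqrt (K * star K) hsa ((hfin.image _).continuousOn _)
    (hfin.continuousOn _)]
  have : (2 : ℂ) • cfc (Real.log ∘ Real.sqrt) (K * star K) =
      (2 : ℝ) • cfc (Real.log ∘ Real.sqrt) (K * star K) := by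
    ext; simp
  rw [this, ← cfc_smul (2 : ℝ) (Real.log ∘ Real.sqrt) (K * star K) (hfin.continuousOn _)]
  refine cfc_congr fun x hx => ?_
  have hx0 : 0 ≤ x := spectrum_nonneg_of_nonneg (mul_star_self_nonneg K) hx
  simp only [Function.comp_apply, Real.log_sqrt hx0, smul_eq_mul]
  ring

end Tensor

/-! ### Localized expectations and their amplitudes -/

section Amplitude

variable {k d : ℕ}

theorem mem_fan {x y : Vertex k} : y ∈ fan x ↔ y = x ∨ ∃ i, y = x ++ [i] := by
  simp [fan, succs, eq_comm]

theorem isPartition_shell (k n : ℕ) : IsPartition (level k n) fan (shell k n) where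
  subset _ := fan_subset_shell
  cover y hy := by
    rcases mem_shell.1 hy with h | h
    · exact ⟨y, mem_level.2 h, mem_fan.2 (Or.inl rfl)⟩
    · have hne : y ≠ [] := by rintro rfl; simp at h
      refine ⟨y.dropLast, mem_level.2 (by simp [h]), mem_fan.2 (Or.inr ⟨y.getLast hne, ?_⟩)⟩
      exact (List.dropLast_append_getLast hne).symm
  unique x hx x' hx' y hy hy' := by
    have key : ∀ z ∈ level k n, y ∈ fan z → y.take n = z := by
      intro z hz h
      rw [mem_level] at hz
      rcases mem_fan.1 h with rfl | ⟨i, rfl⟩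
      · simp [← hz]
      · simp [← hz]
    rw [← key x hx hy, ← key x' hx' hy']

theorem isPartition_succs (k n : ℕ) :
    IsPartition (level k n) (fun x => fan x \ {x}) (ball k (n + 1) \ ball k n) where
  subset x hx y hy := by
    rw [mem_level] at hx
    rw [Finset.mem_sdiff, Finset.mem_singleton, mem_fan] at hy
    obtain ⟨rfl | ⟨i, rfl⟩, h⟩ := hy
    · exact absurd rfl h
    · simp [mem_ball, hx]
  cover y hy := by
    rw [Finset.mem_sdiff, mem_ball, mem_ball] at hy
    obtain ⟨x, hx, hyx⟩ := (isPartition_shell k n).cover y (mem_shell.2 (Or.inr (by omega)))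
    refine ⟨x, hx, Finset.mem_sdiff.2 ⟨hyx, ?_⟩⟩
    rw [Finset.mem_singleton]
    rintro rfl
    exact hy.2 (mem_level.1 hx).le
  unique x hx x' hx' y hy hy' := (isPartition_shell k n).unique x hx x' hx' y
    (Finset.mem_sdiff.1 hy).1 (Finset.mem_sdiff.1 hy').1

theorem ball_sdiff_below (k n : ℕ) : ball k (n + 1) \ below k n = shell k n := by
  ext x
  rw [Finset.mem_sdiff, mem_ball, mem_shell, mem_below]
  omega

/-- Tracing out `W_{n+1}` factorises over the vertices of `W_n`. -/
theorem partialTrace_extend_tensor (n : ℕ) (b : ∀ x : Vertex k, LocalAlg d (fan x)) :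
    partialTrace (ball k n) (ball k (n + 1)) (extend (shell_subset_ball k n)
      (tensor (fun _ => fan_subset_shell) b)) =
    extend (level_subset_ball k n)
      (tensor (fun _ => singleton_subset_level) fun x => partialTrace {x} (fan x) (b x)) := by
  ext ω η
  rw [partialTrace, Matrix.of_apply]
  have hglue (x : level k n) (ω : ball k n → Fin d)
      (ζ : (ball k (n + 1) \ ball k n : Finset (Vertex k)) → Fin d) :
      restr (fan_subset_shell x.2) (restr (shell_subset_ball k n) (glue ω ζ)) =
        glue (restr ((singleton_subset_level x.2).trans (level_subset_ball k n)) ω)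
          (restr ((isPartition_succs k n).subset x x.2) ζ) := by
    funext y
    by_cases hy : (y : Vertex k) = x
    · have hb : (x : Vertex k) ∈ ball k n := level_subset_ball k n x.2
      simp [restr, glue, Finset.restrict₂, hb, hy]
    · have hb : (y : Vertex k) ∉ ball k n := by
        have := (isPartition_succs k n).subset x x.2
          (Finset.mem_sdiff.2 ⟨y.2, by simpa using hy⟩)
        exact (Finset.mem_sdiff.1 this).2
      simp [restr, glue, Finset.restrict₂, hb, hy]
  have hcond (ζ : (ball k (n + 1) \ ball k n : Finset (Vertex k)) → Fin d) :
      (∀ y : ball k (n + 1), (y : Vertex k) ∉ shell k n → glue ω ζ y = glue η ζ y) ↔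
        ∀ y : ball k n, (y : Vertex k) ∉ level k n → ω y = η y := by
    constructor
    · intro H y hy
      have h1 := mem_ball.1 y.2
      rw [mem_level] at hy
      have := H ⟨y, ball_subset_succ k n y.2⟩ (by rw [mem_shell]; simp only; omega)
      simpa [glue] using this
    · intro H y hy
      have h1 := mem_ball.1 y.2
      rw [mem_shell] at hy
      have hb : (y : Vertex k) ∈ ball k n := by rw [mem_ball]; omega
      have := H ⟨y, hb⟩ (by rw [mem_level]; simp only; omega)
      simpa [glue, hb] using this
  simp only [extend_apply, hcond, ← Finset.sum_mul]
  congr 1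
  simp only [tensor, Matrix.of_apply, hglue]
  exact (isPartition_succs k n).sum_prod_restr fun x ζ => b x
    (glue (restr ((singleton_subset_level x.2).trans (level_subset_ball k n)) ω) ζ)
    (glue (restr ((singleton_subset_level x.2).trans (level_subset_ball k n)) η) ζ)

/-- `𝒜_{Λ_{n-1}}` and `𝒜_{Λ_{[n,n+1]}}` commute. -/
theorem commute_extend_below_shell {n : ℕ} (c : LocalAlg d (below k n))
    (b : LocalAlg d (shell k n)) :
    Commute (extend (below_subset_ball_succ k n) c) (extend (shell_subset_ball k n) b) := by
  change _ * _ = _ * _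
  ext ω η
  rw [extend_mul_extend_apply _ _ (ball_sdiff_below k n),
    extend_mul_extend_apply _ _ (ball_sdiff_shell k n), mul_comm]

/-- A localized expectation with amplitude `K` propagates the density matrix by
`D_{n+1} = K D_n K⋆`. -/
theorem density_succ {φ : QuasiLocal (Vertex k) d →ₗ[ℂ] ℂ} {n : ℕ}
    {E : LocalAlg d (ball k (n + 1)) →CP LocalAlg d (ball k n)}
    (hinv : ∀ a, φ (localEmb (ball k n) (E a)) = φ (localEmb (ball k (n + 1)) a))
    {ℰ : ∀ x : Vertex k, LocalAlg d (fan x) →CP LocalAlg d {x}}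
    {K : ∀ x : Vertex k, LocalAlg d (fan x)} (hloc : IsLocalized E ℰ)
    (hK : ∀ x ∈ level k n, IsAmplitude (ℰ x) (K x)) :
    density φ (ball k (n + 1)) =
      extend (shell_subset_ball k n) (levelAmplitude n K) *
        extend (ball_subset_succ k n) (density φ (ball k n)) *
        star (extend (shell_subset_ball k n) (levelAmplitude n K)) := by
  symm
  refine eq_density fun ω η => ?_
  -- Both sides are tested on a matrix unit, which is a product of matrix units of `𝒜_{Λ_{n-1}}`
  -- and of the algebras of the fans.
  obtain ⟨F, -, hEF, hF⟩ := hloc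
  have hP := isPartition_shell k n
  set c : LocalAlg d (below k n) := Matrix.single (restr (below_subset_ball_succ k n) ω)
    (restr (below_subset_ball_succ k n) η) 1 with hc
  set ω' := restr (shell_subset_ball k n) ω
  set η' := restr (shell_subset_ball k n) η
  set a : ∀ x : Vertex k, LocalAlg d (fan x) := fun x =>
    if hx : x ∈ level k n then Matrix.single (restr (hP.subset x hx) ω')
      (restr (hP.subset x hx) η') (1 : ℂ) else 1 with ha
  have hta : tensor (fun _ => fan_subset_shell) a = Matrix.single ω' η' 1 :=
    hP.tensor_single ω' η'
  have hsingle : (Matrix.single ω η 1 : LocalAlg d (ball k (n + 1))) =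
      extend (below_subset_ball_succ k n) c *
        extend (shell_subset_ball k n) (tensor (fun _ => fan_subset_shell) a) := by
    rw [hta]
    ext α β
    rw [extend_mul_extend_apply _ _ (ball_sdiff_below k n), hc, Matrix.single_apply,
      Matrix.single_apply, Matrix.single_apply, ite_one_zero_mul_ite_one_zero]
    refine if_congr ⟨?_, ?_⟩ rfl rfl
    · rintro ⟨rfl, rfl⟩
      exact ⟨⟨rfl, rfl⟩, rfl, rfl⟩
    · have key : ∀ ω α : ball k (n + 1) → Fin d,
          restr (below_subset_ball_succ k n) ω = restr (below_subset_ball_succ k n) α →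
          restr (shell_subset_ball k n) ω = restr (shell_subset_ball k n) α → ω = α := by
        intro ω α h1 h2
        rw [restr_eq_restr_iff] at h1 h2
        funext y
        by_cases hy : (y : Vertex k) ∈ below k n
        · exact h1 y hy
        · exact h2 y (by rw [← ball_sdiff_below]; exact Finset.mem_sdiff.2 ⟨y.2, hy⟩)
      rintro ⟨⟨h1, h2⟩, h3, h4⟩
      exact ⟨key _ _ h1 h3, key _ _ h2 h4⟩
  have hT : tensor (fun _ => singleton_subset_level) (fun x => ℰ x (a x)) =
      tensor (fun _ => singleton_subset_level)
        (fun x : Vertex k => partialTrace {x} (fan x) (star (K x) * a x * K x)) :=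
    tensor_congr (fun _ => singleton_subset_level) fun x hx => hK x hx (a x)
  have hprod : tensor (fun _ => fan_subset_shell) (fun x => star (K x) * a x * K x) =
      star (levelAmplitude n K) * tensor (fun _ => fan_subset_shell) a * levelAmplitude n K := by
    have h1 := hP.tensor_mul (fun x => star (K x) * a x) K
    rw [hP.tensor_mul (fun x => star (K x)) a, tensor_star] at h1
    exact h1
  rw [← hinv, hsingle, hEF, hF, hT, ← partialTrace_extend_tensor, ← trace_density_mul,
    ← Matrix.mul_assoc (density φ (ball k n)), ← trace_extend_mul (ball_subset_succ k n), hprod]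
  simp only [← extendHom_apply, map_mul, map_star]
  simp only [extendHom_apply, extend_extend]
  have hcomm := (commute_extend_below_shell c (star (levelAmplitude n K))).eq
  simp only [← extendHom_apply, map_star] at hcomm
  simp only [extendHom_apply] at hcomm
  set D := extend (ball_subset_succ k n) (density φ (ball k n))
  set T := extend (shell_subset_ball k n) (levelAmplitude n K)
  set C := extend (below_subset_ball_succ k n) c
  set A := extend (shell_subset_ball k n) (tensor (fun _ => fan_subset_shell) a)
  calc (T * D * star T * (C * A)).trace = (T * (D * (star T * C) * A)).trace := by
        simp only [Matrix.mul_assoc]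
    _ = (D * (C * star T) * A * T).trace := by rw [Matrix.trace_mul_comm, hcomm]
    _ = _ := by simp only [Matrix.mul_assoc]

theorem ofReal_re_trace_mul_cfc {n : Type*} [Fintype n] [DecidableEq n] {D : Matrix n n ℂ}
    (hD : D.IsHermitian) (f : ℝ → ℝ) :
    (((D * cfc f D).trace.re : ℝ) : ℂ) = (D * cfc f D).trace := by
  rw [← Complex.conj_eq_iff_re]
  have h1 : star (cfc f D) = cfc f D := (cfc_predicate f D : IsSelfAdjoint (cfc f D))
  have h2 : star (D * cfc f D) = D * cfc f D := by
    rw [star_mul, h1, Matrix.star_eq_conjTranspose, hD]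
    have := cfc_commute_cfc f (fun x => x) D
    rw [cfc_id' ℝ D hD.isSelfAdjoint] at this
    exact this.eq
  have h3 := Matrix.trace_conjTranspose (D * cfc f D)
  rw [← Matrix.star_eq_conjTranspose, h2] at h3
  exact h3.symm

/-- As `K` commutes with `D_n`, the identity `D_{n+1} = K D_n K⋆` becomes `D_{n+1} = D_n (K K⋆)`,
and the logarithm splits. -/
theorem trace_density_mul_log_succ {φ : QuasiLocal (Vertex k) d →ₗ[ℂ] ℂ} (hφ : IsState φ) {n : ℕ}
    {K : ∀ x : Vertex k, LocalAlg d (fan x)}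
    (hD : density φ (ball k (n + 1)) =
      extend (shell_subset_ball k n) (levelAmplitude n K) *
        extend (ball_subset_succ k n) (density φ (ball k n)) *
        star (extend (shell_subset_ball k n) (levelAmplitude n K)))
    (hcomm : Commute (extend (shell_subset_ball k n) (levelAmplitude n K))
        (extend (ball_subset_succ k n) (density φ (ball k n)))) :
    (density φ (ball k (n + 1)) * cfc Real.log (density φ (ball k (n + 1)))).trace =
      (density φ (ball k n) * cfc Real.log (density φ (ball k n))).trace +
        2 * ∑ x ∈ level k n, φ (localEmb (fan x) (cfc Real.log (modulus (K x)))) := by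
  have hP := isPartition_shell k n
  have hDn := (density_posSemidef hφ (ball k n)).isHermitian
  have hDH := (extend_posSemidef (ball_subset_succ k n)
    (density_posSemidef hφ (ball k n))).isHermitian
  set T := extend (shell_subset_ball k n) (levelAmplitude n K) with hTdef
  set D := extend (ball_subset_succ k n) (density φ (ball k n)) with hDdef
  set P : ∀ x : Vertex k, LocalAlg d (fan x) := fun x => K x * star (K x) with hPdef
  have hPH : ∀ x, (P x).IsHermitian := fun x => IsSelfAdjoint.mul_star_self (K x)
  have hR : T * star T = extend (shell_subset_ball k n) (tensor hP.subset P) := by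
    rw [hPdef, hP.tensor_mul, tensor_star, hTdef, ← extendHom_apply, ← map_star, ← map_mul]
    rfl
  have hRH : (T * star T).IsHermitian := IsSelfAdjoint.mul_star_self T
  have hD' : density φ (ball k (n + 1)) = D * (T * star T) := by
    rw [hD, hcomm.eq, Matrix.mul_assoc]
  have hcommR : Commute D (T * star T) := by
    refine hcomm.symm.mul_right ?_
    have := hcomm.star_star
    rw [Matrix.star_eq_conjTranspose D, hDH] at this
    exact this.symm
  have hlogR : T * star T * cfc Real.log (T * star T) = T * star T *
      ∑ x : level k n, extend ((hP.subset x x.2).trans (shell_subset_ball k n))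
        (cfc Real.log (P x)) := by
    rw [hR, cfc_extend _ _ (tensor_isHermitian hP.subset hPH), ← extend_mul,
      hP.tensor_mul_cfc_log hPH, extend_mul]
    congr 1
    rw [← extendHom_apply, map_sum]
    exact Finset.sum_congr rfl fun x _ => extend_extend _ _ _
  have hsplit : density φ (ball k (n + 1)) * cfc Real.log (density φ (ball k (n + 1))) =
      density φ (ball k (n + 1)) * extend (ball_subset_succ k n)
        (cfc Real.log (density φ (ball k n))) +
      density φ (ball k (n + 1)) *
        ∑ x : level k n, extend ((hP.subset x x.2).trans (shell_subset_ball k n))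
          (cfc Real.log (P x)) := by
    rw [hD', mul_cfc_log_mul hDH hRH hcommR, hDdef, cfc_extend _ _ hDn, ← hDdef,
      Matrix.mul_assoc D (T * star T) (cfc Real.log (T * star T)), hlogR]
    simp only [Matrix.mul_assoc]
  rw [hsplit, Matrix.trace_add, trace_density_mul φ (ball k (n + 1)), localEmb_extend,
    trace_density_mul φ (ball k (n + 1)), trace_density_mul φ (ball k n), map_sum, map_sum,
    ← Finset.sum_coe_sort (level k n), Finset.mul_sum]
  congr 1
  refine Finset.sum_congr rfl fun x _ => ?_
  rw [localEmb_extend, hPdef, cfc_log_mul_star, map_smul, map_smul, smul_eq_mul]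

end Amplitude

end CayleyQMS

open CayleyQMS in
theorem mainTheorem1 (k d : ℕ) (hk : 1 ≤ k)
    (φ : QuasiLocal (Vertex k) d →ₗ[ℂ] ℂ)
    (E : ∀ n, LocalAlg d (ball k (n + 1)) →CP LocalAlg d (ball k n))
    (hφ : IsQuantumMarkovState φ E) :
    (∀ n : ℕ, entropy φ (ball k (n + 1)) + entropy φ (level k n) =
      entropy φ (ball k n) + entropy φ (shell k n)) ∧
    (∀ (ℰ : ∀ x : Vertex k, LocalAlg d (fan x) →CP LocalAlg d {x})
      (K : ∀ x : Vertex k, LocalAlg d (fan x)) (n : ℕ),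
      (∀ x ∈ level k n, IsTransitionExp (ℰ x)) → IsLocalized (E n) ℰ →
      (∀ x ∈ level k n, IsAmplitude (ℰ x) (K x)) →
      Commute (extend (shell_subset_ball k n) (levelAmplitude n K))
        (extend (ball_subset_succ k n) (density φ (ball k n))) →
      ((entropy φ (ball k (n + 1)) - entropy φ (ball k n) : ℝ) : ℂ) =
        -2 * ∑ x ∈ level k n, φ (localEmb (fan x) (cfc Real.log (modulus (K x))))) := by
  obtain ⟨⟨φ₀, h, hQMC⟩, hinv⟩ := hφ
  have hφ := hQMC.state
  refine ⟨fun n => entropy_add_entropy hφ (hQMC.quasi n) (hinv n),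
    fun ℰ K n _ hloc hK hcomm => ?_⟩
  have hlog := trace_density_mul_log_succ hφ (density_succ (hinv n) hloc hK) hcomm
  rw [entropy_eq, entropy_eq]
  push_cast
  rw [ofReal_re_trace_mul_cfc (density_posSemidef hφ _).isHermitian,
    ofReal_re_trace_mul_cfc (density_posSemidef hφ _).isHermitian, hlog]
  ring
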